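/- **Theorem (Gottesman–Knill, strong simulation).** For $n\ge 0$ let $\mathcal P_n=\{\pm1,\pm i\}\times\{I,X,Y,Z\}^{\otimes n}$ be the $n$-qubit Pauli group. A unitary $U$ on $k$ qubits is called *Clifford* if $UPU^\dagger\in\mathcal P_k$ for every $P\in\mathcal P_k$. Let $\mathcal G$ be any finite set of Clifford gates, each acting on some fixed finite number of qubits (for example $\mathcal G=\{H,S,\Lambda(X),\Lambda(Z),X,Y,Z\}$). A Clifford circuit $C$ on $n$ qubits over $\mathcal G$ is a finite sequence of gates of $\mathcal G$, each applied to specified pairwise distinct qubits among the $n$; write $U_C$ for the unitary that it implements, and $$P_C(x)=\bigl|\langle x|U_C|0\rangle^{\otimes n}\bigr|^2,\qquad x\in\{0,1\}^n,$$ for the probability of the outcome $x$ when all qubits are measured in the $Z$ basis after $C$ is applied to $|0\rangle^{\otimes n}$. Then there is a deterministic Turing machine, depending only on $\mathcal G$, which, given as input a number $n$ of qubits, a Clifford circuit $C$ on $n$ qubits over $\mathcal G$ (as the list of its gates with the qubits on which they act), a set $A\subseteq\{1,\dots,n\}$ and prescribed outcomes $(m_i)_{i\in A}\in\{0,1\}^A$,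 outputs exactly, in time polynomial in the length of the input, the marginal probability $$\sum_{x\in\{0,1\}^n,\ x_i=m_i\ \forall i\in A}P_C(x)$$ as a rational number (numerator and denominator in binary). In particular, for $A=\{1,\dots,n\}$ it outputs $P_C(x)$ for any given $x$. -/

import Mathlib

namespace GottesmanKnill

/-- Labels of the computational basis of `n` qubits, i.e. bit strings of length `n`. -/
abbrev Bits (n : ℕ) : Type := Fin n → Fin 2

/-- Linear operators on `n` qubits, as matrices in the computational basis. -/
abbrev Op (n : ℕ) : Type := Matrix (Bits n) (Bits n) ℂ

/-- Labels of the four Pauli matrices. -/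
inductive Pauli : Type
  | I
  | X
  | Y
  | Z

/-- The Pauli matrices. -/
def Pauli.toMatrix : Pauli → Matrix (Fin 2) (Fin 2) ℂ
  | .I => !![1, 0; 0, 1]
  | .X => !![0, 1; 1, 0]
  | .Y => !![0, -Complex.I; Complex.I, 0]
  | .Z => !![1, 0; 0, -1]

/-- The tensor product `P₀ ⊗ ⋯ ⊗ Pₙ₋₁` of Pauli matrices. -/
def pauliTensor {n : ℕ} (P : Fin n → Pauli) : Op n :=
  Matrix.of fun x y => ∏ i, (P i).toMatrix (x i) (y i)

/-- The `n`-qubit Pauli group `{±1, ±i} × {I, X, Y, Z}^{⊗ n}`, as a set of operators. -/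
def pauliGroup (n : ℕ) : Set (Op n) :=
  {M | ∃ c : ℂ, (c = 1 ∨ c = -1 ∨ c = Complex.I ∨ c = -Complex.I) ∧
    ∃ P : Fin n → Pauli, M = c • pauliTensor P}

/-- A Clifford operation: a unitary that transforms every Pauli product into a Pauli product
under conjugation. -/
def IsClifford {n : ℕ} (U : Op n) : Prop :=
  U ∈ Matrix.unitaryGroup (Bits n) ℂ ∧
    ∀ M ∈ pauliGroup n, U * M * U.conjTranspose ∈ pauliGroup n

/-- The operator on `n` qubits that applies the `k`-qubit operator `U` to the qubits
`q 0, …, q (k - 1)` (in this order) and the identity to all the other qubits. -/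
def applyOn {k n : ℕ} (U : Op k) (q : Fin k ↪ Fin n) : Op n :=
  open Classical in
  Matrix.of fun x y =>
    if ∀ j, j ∉ Set.range q → x j = y j then U (fun i => x (q i)) (fun i => y (q i)) else 0

/-- A circuit on `n` qubits over a gate set whose gate `g` acts on `arity g` qubits: the list, in
the order of time, of the gates with the pairwise distinct qubits to which they are applied. -/
abbrev Circuit {G : Type} (arity : G → ℕ) (n : ℕ) : Type :=
  List ((g : G) × (Fin (arity g) ↪ Fin n))

/-- The state vector `|0⟩^{⊗ n}`. -/
def zeroState (n : ℕ) : Bits n → ℂ := Pi.single (fun _ => 0) 1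

/-- The state to which a circuit takes `|0⟩^{⊗ n}`. -/
noncomputable def outputState {G : Type} {arity : G → ℕ} (gate : (g : G) → Op (arity g)) {n : ℕ}
    (C : Circuit arity n) : Bits n → ℂ :=
  C.foldl (fun ψ s => (applyOn (gate s.1) s.2).mulVec ψ) (zeroState n)

/-- The probability `P_C(x) = |⟨x|ψ⟩|²` that measuring all the qubits in the `Z` basis after the
circuit yields `x`. -/
noncomputable def outputProb {G : Type} {arity : G → ℕ} (gate : (g : G) → Op (arity g)) {n : ℕ}
    (C : Circuit arity n) (x : Bits n) : ℝ :=
  ‖outputState gate C x‖ ^ 2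

/-- The marginal `∑ P_C(x)` over all `x` with `x i = b` whenever `m i = some b`. Qubits with
`m i = none` are summed over; if there are none of these, this is `P_C(x)` itself. -/
noncomputable def marginalProb {G : Type} {arity : G → ℕ} (gate : (g : G) → Op (arity g)) {n : ℕ}
    (C : Circuit arity n) (m : Fin n → Option (Fin 2)) : ℝ :=
  open Classical in
  ∑ x : Bits n with ∀ i b, m i = some b → x i = b, outputProb gate C x

/-- An instance of the strong simulation problem: a circuit together with the requested outcome on
an arbitrary set of qubits. -/
structure Query {G : Type} (arity : G → ℕ) : Type where
  /-- the number of qubits -/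
  n : ℕ
  /-- the circuit -/
  circuit : Circuit arity n
  /-- the requested outcomes; `none` for the qubits that are summed over -/
  outcome : Fin n → Option (Fin 2)

/-- The input alphabet. -/
inductive Sym (G : Type) : Type
  /-- the requested outcome of one qubit (`none` if it is summed over) -/
  | outcome (b : Option (Fin 2))
  /-- the name of a gate -/
  | gate (g : G)
  /-- a unary digit of the index of a qubit -/
  | tick
  /-- the end of the index of a qubit -/
  | endIndex

/-- One gate is written as its name, followed by the indices of the qubits on which it acts. -/
def encodeStep {G : Type} {arity : G → ℕ} {n : ℕ} (s : (g : G) × (Fin (arity g) ↪ Fin n)) :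
    List (Sym G) :=
  Sym.gate s.1 ::
    (List.ofFn s.2).flatMap fun j => List.replicate (j : ℕ) Sym.tick ++ [Sym.endIndex]

/-- The input string: one symbol for each of the `n` qubits with its requested outcome, followed by
the gates. As the indices of qubits are smaller than `n` and the string has at least `n` symbols,
writing them in unary rather than binary changes the length only polynomially. -/
def encodeQuery {G : Type} {arity : G → ℕ} (Q : Query arity) : List (Sym G) :=
  (List.ofFn Q.outcome).map Sym.outcome ++ Q.circuit.flatMap encodeStep

/-- The output string: a non-negative rational number in lowest terms, as numerator and denominator
in binary, separated by `none`. -/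
def encodeNNRat (r : ℚ≥0) : List (Option Bool) :=
  (Computability.encodeNat r.num).map some ++ none :: (Computability.encodeNat r.den).map some

end GottesmanKnill

namespace GottesmanKnill

section

/-! ### A structured language for stack machines -/

section Language

variable {K : Type} {Γ : K → Type} {σ : Type}

/-! Write `U` for the operator of the circuit and Π for the projection onto the requested outcomes.
The marginal is ⟨0|U†ΠU|0⟩, the entry at `0` of the vector v = U†ΠU|0⟩ (`pulledBack`,
`marginalProb_eq`). Π is a product of factors (1 ± Z_i)/2, one for each requested outcome, and r =
U†(±Z_i)U is a Pauli product with a phase, a "row", which is computed gate by gate from the end of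
the circuit (`exec_circuit`). Taking one more outcome into account replaces v by (v + r v)/2.

The rows are treated as in Gaussian elimination on the sets of qubits that they flip. As long as v
has not become 0, the recorded rows fix v, so multiplying r by them does not change r v
(`foldl_reduceBy_spec`); in this way r becomes a row s that flips none of the earlier pivots. If s
flips some qubit, then (s v)(0) is a phase times the entry of v at a nonzero string that vanishes at
all earlier pivots. Such entries are 0, so v(0) is halved. If s is diagonal, |0⟩ is an eigenvector
of s with eigenvalue ±1, and therefore so is v: for +1 nothing changes, for -1 the new v is 0. Hence
the marginal is 0 or 2^(-k), where k counts the reduced rows that flip a qubit. This is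
`Invariant.step`.

The machine keeps one row, with one cell per qubit, and a list of instructions: the circuit
backwards, followed by the recorded rows. Replaying this list on ±Z_i conjugates and then reduces
(`exec_stepInstrs`, `exec_rowInstrs`, `run_round`). As the gate set is finite, conjugation by the
gates is a finite table (`exists_table`), which is built into the control. There are at most n
rounds, each replaying quadratically many instructions by sweeps over n cells, so the time is
polynomial. The programs are written in a small structured language that compiles to `Turing.FinTM2`
with exact step counts (`Exec.iterate_step`, `Cmd.toTM_outputs`). -/

/-- Structured programs that operate on a finite register of type `σ` and on stacks. -/
inductive Cmd (Γ : K → Type) (σ : Type) : Type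
  | push (k : K) (f : σ → Γ k)
  | pop (k : K) (f : σ → Option (Γ k) → σ)
  | load (f : σ → σ)
  | seq (p q : Cmd Γ σ)
  | ite (f : σ → Bool) (p q : Cmd Γ σ)
  | loop (f : σ → Bool) (p : Cmd Γ σ)

/-- The contents of the register and of the stacks. -/
abbrev Store (Γ : K → Type) (σ : Type) : Type := σ × ∀ k, List (Γ k)

/-- `Exec p a b t`: the program `p`, started with store `a`, ends with store `b` after `t` steps. -/
inductive Exec [DecidableEq K] : Cmd Γ σ → Store Γ σ → Store Γ σ → ℕ → Prop
  | push (k : K) (f : σ → Γ k) (a : Store Γ σ) :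
      Exec (.push k f) a (a.1, Function.update a.2 k (f a.1 :: a.2 k)) 1
  | pop (k : K) (f : σ → Option (Γ k) → σ) (a : Store Γ σ) :
      Exec (.pop k f) a (f a.1 (a.2 k).head?, Function.update a.2 k (a.2 k).tail) 1
  | load (f : σ → σ) (a : Store Γ σ) : Exec (.load f) a (f a.1, a.2) 1
  | seq {p q : Cmd Γ σ} {a b c : Store Γ σ} {t u : ℕ} :
      Exec p a b t → Exec q b c u → Exec (.seq p q) a c (t + u)
  | iteTrue {f : σ → Bool} {p q : Cmd Γ σ} {a b : Store Γ σ} {t : ℕ} :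
      f a.1 = true → Exec p a b t → Exec (.ite f p q) a b (t + 1)
  | iteFalse {f : σ → Bool} {p q : Cmd Γ σ} {a b : Store Γ σ} {t : ℕ} :
      f a.1 = false → Exec q a b t → Exec (.ite f p q) a b (t + 1)
  | loopTrue {f : σ → Bool} {p : Cmd Γ σ} {a b c : Store Γ σ} {t u : ℕ} :
      f a.1 = true → Exec p a b t → Exec (.loop f p) b c u → Exec (.loop f p) a c (t + u + 1)
  | loopFalse {f : σ → Bool} {p : Cmd Γ σ} {a : Store Γ σ} :
      f a.1 = false → Exec (.loop f p) a a 1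

namespace Cmd

/-- The labels of the machine code of a program. -/
def Label : Cmd Γ σ → Type
  | push _ _ => Unit
  | pop _ _ => Unit
  | load _ => Unit
  | seq p q => p.Label ⊕ q.Label
  | ite _ p q => Option (p.Label ⊕ q.Label)
  | loop _ p => Option p.Label

/-- The label at which the machine code of a program starts. -/
def entry : (p : Cmd Γ σ) → p.Label
  | push _ _ => ()
  | pop _ _ => ()
  | load _ => ()
  | seq p _ => Sum.inl p.entry
  | ite _ _ _ => none
  | loop _ _ => none

theorem finite_label : (p : Cmd Γ σ) → Finite p.Label
  | push _ _ => inferInstanceAs (Finite Unit)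
  | pop _ _ => inferInstanceAs (Finite Unit)
  | load _ => inferInstanceAs (Finite Unit)
  | seq p q => by
      have := finite_label p
      have := finite_label q
      exact inferInstanceAs (Finite (p.Label ⊕ q.Label))
  | ite _ p q => by
      have := finite_label p
      have := finite_label q
      exact inferInstanceAs (Finite (Option (p.Label ⊕ q.Label)))
  | loop _ p => by
      have := finite_label p
      exact inferInstanceAs (Finite (Option p.Label))

open Turing.TM2 in
/-- The machine code of a program, with its labels embedded into `Λ` by `e`, which ends with a jump
to `exit`. -/
def code {Λ : Type} : (p : Cmd Γ σ) → (e : p.Label → Λ) → (exit : Λ) → p.Label → Stmt Γ Λ σ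
  | push k f, _, exit, _ => Stmt.push k f (Stmt.goto fun _ => exit)
  | pop k f, _, exit, _ => Stmt.pop k f (Stmt.goto fun _ => exit)
  | load f, _, exit, _ => Stmt.load f (Stmt.goto fun _ => exit)
  | seq p q, e, _, Sum.inl l => p.code (fun l => e (Sum.inl l)) (e (Sum.inr q.entry)) l
  | seq _ q, e, exit, Sum.inr l => q.code (fun l => e (Sum.inr l)) exit l
  | ite f p q, e, _, none =>
      Stmt.branch f (Stmt.goto fun _ => e (some (Sum.inl p.entry)))
        (Stmt.goto fun _ => e (some (Sum.inr q.entry)))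
  | ite _ p _, e, exit, some (Sum.inl l) => p.code (fun l => e (some (Sum.inl l))) exit l
  | ite _ _ q, e, exit, some (Sum.inr l) => q.code (fun l => e (some (Sum.inr l))) exit l
  | loop f p, e, exit, none =>
      Stmt.branch f (Stmt.goto fun _ => e (some p.entry)) (Stmt.goto fun _ => exit)
  | loop _ p, e, _, some l => p.code (fun l => e (some l)) (e none) l

end Cmd

variable [DecidableEq K]

theorem iterate_bind_add {α : Type} {f : α → Option α} {a b : α} {c : Option α} {t u : ℕ}
    (h₁ : (flip bind f)^[t] (some a) = some b) (h₂ : (flip bind f)^[u] (some b) = c) :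
    (flip bind f)^[t + u] (some a) = c := by
  rw [Nat.add_comm, Function.iterate_add_apply, h₁, h₂]

/-- Code leaves a program by a jump to `exit` and never halts, so the claim can be made for every
embedding of the labels and every exit. The exit of the first half of a `seq` is the entry of the
second half, and the exit of a loop body is the test of the loop; runs are then concatenated. -/
theorem Exec.iterate_step {Λ : Type} (M : Λ → Turing.TM2.Stmt Γ Λ σ) {p : Cmd Γ σ}
    {a b : Store Γ σ} {t : ℕ} (h : Exec p a b t) :
    ∀ (e : p.Label → Λ) (exit : Λ), (∀ l, M (e l) = p.code e exit l) →
      (flip bind (Turing.TM2.step M))^[t] (some ⟨some (e p.entry), a.1, a.2⟩) =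
        some ⟨some exit, b.1, b.2⟩ := by
  induction h with
  | push k f a =>
      intro e exit hM
      simp [flip, hM, Cmd.code]
  | pop k f a =>
      intro e exit hM
      simp [flip, hM, Cmd.code]
  | load f a =>
      intro e exit hM
      simp [flip, hM, Cmd.code]
  | seq _ _ ih₁ ih₂ =>
      intro e exit hM
      exact iterate_bind_add
        (ih₁ (fun l => e (Sum.inl l)) (e (Sum.inr (Cmd.entry _))) fun l => hM (Sum.inl l))
        (ih₂ (fun l => e (Sum.inr l)) exit fun l => hM (Sum.inr l))
  | iteTrue hf _ ih =>
      intro e exit hM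
      rw [Nat.add_comm]
      refine iterate_bind_add ?_
        (ih (fun l => e (some (Sum.inl l))) exit fun l => hM (some (Sum.inl l)))
      have h := hM none
      simp only [Cmd.code] at h
      simp [flip, Cmd.entry, h, hf]
  | iteFalse hf _ ih =>
      intro e exit hM
      rw [Nat.add_comm]
      refine iterate_bind_add ?_
        (ih (fun l => e (some (Sum.inr l))) exit fun l => hM (some (Sum.inr l)))
      have h := hM none
      simp only [Cmd.code] at h
      simp [flip, Cmd.entry, h, hf]
  | loopTrue hf _ _ ih₁ ih₂ =>
      intro e exit hM
      rw [Nat.add_comm]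
      refine iterate_bind_add ?_ (iterate_bind_add
        (ih₁ (fun l => e (some l)) (e none) fun l => hM (some l)) (ih₂ e exit hM))
      have h := hM none
      simp only [Cmd.code] at h
      simp [flip, Cmd.entry, h, hf]
  | loopFalse hf =>
      intro e exit hM
      have h := hM none
      simp only [Cmd.code] at h
      simp [flip, Cmd.entry, h, hf]

/-- The machine that runs a program and halts. -/
noncomputable def Cmd.toTM [Finite K] [Finite σ] (p : Cmd Γ σ) (k₀ k₁ : K) [Finite (Γ k₀)]
    (v : σ) : Turing.FinTM2 :=
  letI := Fintype.ofFinite K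
  letI := Fintype.ofFinite σ
  letI := Fintype.ofFinite (Γ k₀)
  letI := p.finite_label
  letI := Fintype.ofFinite p.Label
  { k₀ := k₀
    k₁ := k₁
    Γ := Γ
    Λ := Option p.Label
    main := some p.entry
    σ := σ
    initialState := v
    m := fun l => l.elim Turing.TM2.Stmt.halt (p.code some none) }

/-- This is the form in which `Turing.initList` and `Turing.haltList` fill a single stack. -/
theorem dite_eq_update (k₀ : K) (l : List (Γ k₀)) (k : K) :
    (if h : k = k₀ then Eq.mpr (congrArg (fun k => List (Γ k)) h) l else []) =
      Function.update (fun _ => []) k₀ l k := by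
  by_cases hk : k = k₀
  · subst hk
    simp
  · simp [hk]

/-- `Turing.haltList` demands the initial register and empty stacks except for the output. This is
why the program has to clean up before it ends. -/
theorem Cmd.toTM_outputs [Finite K] [Finite σ] (p : Cmd Γ σ) (k₀ k₁ : K) [Finite (Γ k₀)]
    (v : σ) (l : List (Γ k₀)) (l' : List (Γ k₁)) {t m : ℕ}
    (h : Exec p (v, Function.update (fun _ => []) k₀ l) (v, Function.update (fun _ => []) k₁ l') t)
    (hm : t + 1 ≤ m) :
    Nonempty (Turing.TM2OutputsInTime (p.toTM k₀ k₁ v) l (some l') m) := by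
  have h₁ := h.iterate_step (fun l => l.elim Turing.TM2.Stmt.halt (p.code some none)) some none
    fun l => rfl
  -- The additional step executes `halt` at the label `none`, the exit of the program.
  have h₂ := iterate_bind_add (u := 1) h₁ rfl
  have h₀ : Turing.initList (p.toTM k₀ k₁ v) l =
      (⟨some (some p.entry), v, Function.update (fun _ => []) k₀ l⟩ :
        Turing.TM2.Cfg Γ (Option p.Label) σ) :=
    congrArg (Turing.TM2.Cfg.mk (some (some p.entry)) v) (funext (dite_eq_update k₀ l))
  have h₃ : Turing.haltList (p.toTM k₀ k₁ v) l' =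
      (⟨none, v, Function.update (fun _ => []) k₁ l'⟩ :
        Turing.TM2.Cfg Γ (Option p.Label) σ) :=
    congrArg (Turing.TM2.Cfg.mk none v) (funext (dite_eq_update k₁ l'))
  exact ⟨⟨⟨t + 1, ((congrArg (fun c => (flip bind (p.toTM k₀ k₁ v).step)^[t + 1] (some c)) h₀).trans
    h₂).trans (congrArg some h₃.symm)⟩, hm⟩⟩

end Language

end

section

/-! ### The program -/

instance : Finite Pauli :=
  Finite.of_surjective (fun i : Fin 4 => match i with
    | 0 => Pauli.I
    | 1 => Pauli.X
    | 2 => Pauli.Y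
    | 3 => Pauli.Z) fun p => by
      cases p
      exacts [⟨0, rfl⟩, ⟨1, rfl⟩, ⟨2, rfl⟩, ⟨3, rfl⟩]

/-- Whether a Pauli matrix flips the bit. -/
def Pauli.hasX : Pauli → Bool
  | .I => false
  | .X => true
  | .Y => true
  | .Z => false

/-- The product of two Pauli matrices up to the phase `Pauli.phase`. -/
def Pauli.mul : Pauli → Pauli → Pauli
  | .I, q => q
  | p, .I => p
  | .X, .X => .I
  | .X, .Y => .Z
  | .X, .Z => .Y
  | .Y, .X => .Z
  | .Y, .Y => .I
  | .Y, .Z => .X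
  | .Z, .X => .Y
  | .Z, .Y => .X
  | .Z, .Z => .I

/-- The exponent of `i` in the product of two Pauli matrices. -/
def Pauli.phase : Pauli → Pauli → ZMod 4
  | .X, .Y => 1
  | .X, .Z => 3
  | .Y, .X => 3
  | .Y, .Z => 1
  | .Z, .X => 1
  | .Z, .Y => 3
  | _, _ => 0

variable {G : Type}

/-- The places of the gates of a gate set. -/
abbrev Slot (arity : G → ℕ) : Type := (g : G) × Fin (arity g)

/-- The instructions by which a row (a product of Pauli matrices) is transformed. -/
inductive Instr (arity : G → ℕ) : Type
  /-- move to the next qubit, and note an entry of another row -/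
  | entry (p : Pauli)
  /-- mark the current qubit as a place of a gate, and return to the first qubit -/
  | mark (s : Slot arity)
  /-- conjugate the row with a gate at the marked qubits -/
  | gate (g : G)
  /-- reduce the row with the other row, whose phase is `c`, and return to the first qubit -/
  | finish (c : ZMod 4)

/-- The memory cell of one qubit. -/
structure Cell (arity : G → ℕ) : Type where
  /-- the entry of the row -/
  p : Pauli
  /-- the entry of the row by which the current row is reduced -/
  q : Pauli
  /-- the place of the current gate -/
  slot : Option (Slot arity)
  /-- the requested outcome, unless it has been taken into account -/
  out : Option (Fin 2)

/-- The finite register of the machine. -/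
structure Reg (arity : G → ℕ) : Type where
  sym : Option (Sym G)
  ins : Option (Instr arity)
  cell : Option (Cell arity)
  cur : Option (Slot arity)
  vals : Slot arity → Pauli
  phase : ZMod 4
  flag : Bool
  hasX : Bool
  found : Bool
  fail : Bool

variable {arity : G → ℕ}

instance : Inhabited (Instr arity) := ⟨.entry .I⟩

instance : Inhabited (Cell arity) := ⟨⟨.I, .I, none, none⟩⟩

/-- The initial register. -/
def Reg.init (arity : G → ℕ) : Reg arity :=
  ⟨none, none, none, none, fun _ => .I, 0, false, false, false, false⟩

instance [Finite G] : Finite (Sym G) := by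
  let f : Option (Fin 2) ⊕ G ⊕ Bool → Sym G := fun x => match x with
    | .inl b => .outcome b
    | .inr (.inl g) => .gate g
    | .inr (.inr true) => .tick
    | .inr (.inr false) => .endIndex
  refine Finite.of_surjective f fun s => ?_
  cases s with
  | outcome b => exact ⟨.inl b, rfl⟩
  | gate g => exact ⟨.inr (.inl g), rfl⟩
  | tick => exact ⟨.inr (.inr true), rfl⟩
  | endIndex => exact ⟨.inr (.inr false), rfl⟩

instance [Finite G] : Finite (Instr arity) := by
  let f : Pauli ⊕ Slot arity ⊕ G ⊕ ZMod 4 → Instr arity := fun x => match x with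
    | .inl p => .entry p
    | .inr (.inl s) => .mark s
    | .inr (.inr (.inl g)) => .gate g
    | .inr (.inr (.inr c)) => .finish c
  have : Finite (ZMod 4) := inferInstanceAs (Finite (Fin 4))
  refine Finite.of_surjective f fun s => ?_
  cases s with
  | entry p => exact ⟨.inl p, rfl⟩
  | mark s => exact ⟨.inr (.inl s), rfl⟩
  | gate g => exact ⟨.inr (.inr (.inl g)), rfl⟩
  | finish c => exact ⟨.inr (.inr (.inr c)), rfl⟩

instance [Finite G] : Finite (Cell arity) :=
  Finite.of_injective (fun e => (e.p, e.q, e.slot, e.out)) fun e e' h => by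
    cases e
    cases e'
    simpa using h

instance [Finite G] : Finite (Reg arity) :=
  have : Finite (ZMod 4) := inferInstanceAs (Finite (Fin 4))
  Finite.of_injective (fun v => (v.sym, v.ins, v.cell, v.cur, v.vals, v.phase, v.flag, v.hasX,
    v.found, v.fail)) fun v v' h => by
      cases v
      cases v'
      simpa using h

/-- The stacks of the machine. -/
inductive Stk : Type
  | inp
  | out
  | ins
  | done
  | right
  | left
  deriving DecidableEq

instance : Finite Stk :=
  Finite.of_surjective (fun i : Fin 6 => match i with
    | 0 => Stk.inp
    | 1 => Stk.out
    | 2 => Stk.ins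
    | 3 => Stk.done
    | 4 => Stk.right
    | 5 => Stk.left) fun k => by
      cases k
      exacts [⟨0, rfl⟩, ⟨1, rfl⟩, ⟨2, rfl⟩, ⟨3, rfl⟩, ⟨4, rfl⟩, ⟨5, rfl⟩]

/-- The alphabets of the stacks. -/
abbrev Alphabet (arity : G → ℕ) : Stk → Type
  | .inp => Sym G
  | .out => Option Bool
  | .ins => Instr arity
  | .done => Instr arity
  | .right => Cell arity
  | .left => Cell arity

/-- The memory of the machine. -/
structure Mem (arity : G → ℕ) : Type where
  v : Reg arity
  inp : List (Sym G)
  out : List (Option Bool)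
  ins : List (Instr arity)
  done : List (Instr arity)
  right : List (Cell arity)
  left : List (Cell arity)

/-- The memory as the contents of stacks indexed by `Stk`. -/
def Mem.stk (m : Mem arity) : (k : Stk) → List (Alphabet arity k)
  | .inp => m.inp
  | .out => m.out
  | .ins => m.ins
  | .done => m.done
  | .right => m.right
  | .left => m.left

/-- Programs for the machine. -/
abbrev Prog (arity : G → ℕ) : Type := Cmd (Alphabet arity) (Reg arity)

/-- Push a symbol, which is computed from the register. -/
abbrev Prog.push (k : Stk) (f : Reg arity → Alphabet arity k) : Prog arity := Cmd.push k f

/-- Pop a symbol, and take it into account in the register. -/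
abbrev Prog.pop (k : Stk) (f : Reg arity → Option (Alphabet arity k) → Reg arity) : Prog arity :=
  Cmd.pop k f

/-- `Run p m m' t`: the program `p` transforms the memory `m` into `m'` in at most `t` steps. -/
def Run (p : Prog arity) (m m' : Mem arity) (t : ℕ) : Prop :=
  ∃ u ≤ t, Exec p (m.v, m.stk) (m'.v, m'.stk) u

namespace Run

variable {p q : Prog arity} {m m₁ m₂ : Mem arity} {t u : ℕ}

theorem mono (h : Run p m m₁ t) (htu : t ≤ u) : Run p m m₁ u :=
  let ⟨s, hs, he⟩ := h
  ⟨s, hs.trans htu, he⟩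

theorem seq (h₁ : Run p m m₁ t) (h₂ : Run q m₁ m₂ u) : Run (p.seq q) m m₂ (t + u) :=
  let ⟨_, hs₁, he₁⟩ := h₁
  let ⟨_, hs₂, he₂⟩ := h₂
  ⟨_, Nat.add_le_add hs₁ hs₂, he₁.seq he₂⟩

theorem iteTrue {f : Reg arity → Bool} (hf : f m.v = true) (h : Run p m m₁ t) :
    Run (.ite f p q) m m₁ (t + 1) :=
  let ⟨_, hs, he⟩ := h
  ⟨_, Nat.add_le_add_right hs 1, .iteTrue hf he⟩

theorem iteFalse {f : Reg arity → Bool} (hf : f m.v = false) (h : Run q m m₁ t) :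
    Run (.ite f p q) m m₁ (t + 1) :=
  let ⟨_, hs, he⟩ := h
  ⟨_, Nat.add_le_add_right hs 1, .iteFalse hf he⟩

theorem loopTrue {f : Reg arity → Bool} (hf : f m.v = true) (h₁ : Run p m m₁ t)
    (h₂ : Run (.loop f p) m₁ m₂ u) : Run (.loop f p) m m₂ (t + u + 1) :=
  let ⟨_, hs₁, he₁⟩ := h₁
  let ⟨_, hs₂, he₂⟩ := h₂
  ⟨_, Nat.add_le_add_right (Nat.add_le_add hs₁ hs₂) 1, .loopTrue hf he₁ he₂⟩

theorem loopFalse {f : Reg arity → Bool} (hf : f m.v = false) : Run (.loop f p) m m 1 :=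
  ⟨1, le_rfl, .loopFalse hf⟩

theorem load (f : Reg arity → Reg arity) : Run (.load f) m { m with v := f m.v } 1 :=
  ⟨1, le_rfl, .load f _⟩

/-- `Exec` describes stacks by `Function.update`, `Mem` by named fields. A comparison stack by stack
passes from one to the other. -/
theorem push_of_stk {k : Stk} {f : Reg arity → Alphabet arity k} (hv : m₁.v = m.v)
    (hk : m₁.stk k = f m.v :: m.stk k) (hne : ∀ j, j ≠ k → m₁.stk j = m.stk j) :
    Run (.push k f) m m₁ 1 := by
  refine ⟨1, le_rfl, ?_⟩
  have h : (m₁.v, m₁.stk) = (m.v, Function.update m.stk k (f m.v :: m.stk k)) := by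
    rw [hv]
    congr 1
    exact Function.eq_update_iff.2 ⟨hk, hne⟩
  rw [h]
  exact .push k f _

theorem pop_of_stk {k : Stk} {f : Reg arity → Option (Alphabet arity k) → Reg arity}
    (hv : m₁.v = f m.v (m.stk k).head?) (hk : m₁.stk k = (m.stk k).tail)
    (hne : ∀ j, j ≠ k → m₁.stk j = m.stk j) : Run (.pop k f) m m₁ 1 := by
  refine ⟨1, le_rfl, ?_⟩
  have h : (m₁.v, m₁.stk) =
      (f m.v (m.stk k).head?, Function.update m.stk k (m.stk k).tail) := by
    rw [hv]
    congr 1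
    exact Function.eq_update_iff.2 ⟨hk, hne⟩
  rw [h]
  exact .pop k f _

theorem pushOut (f : Reg arity → Option Bool) :
    Run (.push .out f) m { m with out := f m.v :: m.out } 1 :=
  push_of_stk rfl rfl fun j hj => by cases j <;> first | rfl | exact absurd rfl hj

theorem pushIns (f : Reg arity → Instr arity) :
    Run (.push .ins f) m { m with ins := f m.v :: m.ins } 1 :=
  push_of_stk rfl rfl fun j hj => by cases j <;> first | rfl | exact absurd rfl hj

theorem pushDone (f : Reg arity → Instr arity) :
    Run (.push .done f) m { m with done := f m.v :: m.done } 1 :=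
  push_of_stk rfl rfl fun j hj => by cases j <;> first | rfl | exact absurd rfl hj

theorem pushRight (f : Reg arity → Cell arity) :
    Run (.push .right f) m { m with right := f m.v :: m.right } 1 :=
  push_of_stk rfl rfl fun j hj => by cases j <;> first | rfl | exact absurd rfl hj

theorem pushLeft (f : Reg arity → Cell arity) :
    Run (.push .left f) m { m with left := f m.v :: m.left } 1 :=
  push_of_stk rfl rfl fun j hj => by cases j <;> first | rfl | exact absurd rfl hj

theorem popInp (f : Reg arity → Option (Sym G) → Reg arity) :
    Run (.pop .inp f) m { m with v := f m.v m.inp.head?, inp := m.inp.tail } 1 :=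
  pop_of_stk rfl rfl fun j hj => by cases j <;> first | rfl | exact absurd rfl hj

theorem popOut (f : Reg arity → Option (Option Bool) → Reg arity) :
    Run (.pop .out f) m { m with v := f m.v m.out.head?, out := m.out.tail } 1 :=
  pop_of_stk rfl rfl fun j hj => by cases j <;> first | rfl | exact absurd rfl hj

theorem popIns (f : Reg arity → Option (Instr arity) → Reg arity) :
    Run (.pop .ins f) m { m with v := f m.v m.ins.head?, ins := m.ins.tail } 1 :=
  pop_of_stk rfl rfl fun j hj => by cases j <;> first | rfl | exact absurd rfl hj

theorem popDone (f : Reg arity → Option (Instr arity) → Reg arity) :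
    Run (.pop .done f) m { m with v := f m.v m.done.head?, done := m.done.tail } 1 :=
  pop_of_stk rfl rfl fun j hj => by cases j <;> first | rfl | exact absurd rfl hj

theorem popRight (f : Reg arity → Option (Cell arity) → Reg arity) :
    Run (.pop .right f) m { m with v := f m.v m.right.head?, right := m.right.tail } 1 :=
  pop_of_stk rfl rfl fun j hj => by cases j <;> first | rfl | exact absurd rfl hj

theorem popLeft (f : Reg arity → Option (Cell arity) → Reg arity) :
    Run (.pop .left f) m { m with v := f m.v m.left.head?, left := m.left.tail } 1 :=
  pop_of_stk rfl rfl fun j hj => by cases j <;> first | rfl | exact absurd rfl hj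

end Run

end

section

variable {G : Type} {arity : G → ℕ}

/-! ### Sweeps over the row -/

/-- Apply a transducer to the cell in the register. -/
def Reg.transduce (τ : Reg arity → Cell arity → Reg arity × Cell arity) (v : Reg arity) :
    Reg arity :=
  { (τ { v with cell := none } (v.cell.getD default)).1 with
    cell := some (τ { v with cell := none } (v.cell.getD default)).2 }

/-- Store a cell in the register. -/
def Reg.setCell (v : Reg arity) (o : Option (Cell arity)) : Reg arity := { v with cell := o }

/-- The cell in the register. -/
def Reg.getCell (v : Reg arity) : Cell arity := v.cell.getD default

/-- One step of a transducer that moves cells to another stack. -/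
def sweepStep (τ : Reg arity → Cell arity → Reg arity × Cell arity)
    (s : Reg arity × List (Cell arity)) (e : Cell arity) : Reg arity × List (Cell arity) :=
  ((τ s.1 e).1, (τ s.1 e).2 :: s.2)

/-- Move all cells from the right to the left. -/
def sweepRight (τ : Reg arity → Cell arity → Reg arity × Cell arity) : Prog arity :=
  (Prog.pop .right Reg.setCell).seq <| .loop (fun v => v.cell.isSome) <|
    (Cmd.load (Reg.transduce τ)).seq <| (Prog.push .left Reg.getCell).seq <|
      Prog.pop .right Reg.setCell

/-- Move all cells from the left to the right. -/
def sweepLeft (τ : Reg arity → Cell arity → Reg arity × Cell arity) : Prog arity :=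
  (Prog.pop .left Reg.setCell).seq <| .loop (fun v => v.cell.isSome) <|
    (Cmd.load (Reg.transduce τ)).seq <| (Prog.push .right Reg.getCell).seq <|
      Prog.pop .left Reg.setCell

theorem Reg.setCell_none {v : Reg arity} (h : v.cell = none) : { v with cell := none } = v := by
  cases v
  simp_all

section Sweep

variable {τ : Reg arity → Cell arity → Reg arity × Cell arity}
  (hτ : ∀ v e, v.cell = none → (τ v e).1.cell = none)

-- Each cell costs four steps: the test of the loop, the transduction, a push and a pop. The
-- transducer must not fill `cell`, because an empty `cell` is what ends the loop.
include hτ in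
theorem run_sweepRight (m : Mem arity) (hm : m.v.cell = none) :
    Run (sweepRight τ) m
      { m with
        v := (m.right.foldl (sweepStep τ) (m.v, m.left)).1
        left := (m.right.foldl (sweepStep τ) (m.v, m.left)).2
        right := [] } (4 * m.right.length + 2) := by
  -- The loop is entered when its first item has already been popped, so the induction is on a list
  -- whose head is in the register and whose tail is on the stack. The other loops are treated in
  -- the same way.
  have key : ∀ (R L : List (Cell arity)) (v : Reg arity), v.cell = none →
      Run (.loop (fun v => v.cell.isSome) <|
        (Cmd.load (Reg.transduce τ)).seq <| (Prog.push .left Reg.getCell).seq <|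
        Prog.pop .right Reg.setCell)
        { m with v := { v with cell := R.head? }, right := R.tail, left := L }
        { m with
          v := (R.foldl (sweepStep τ) (v, L)).1
          left := (R.foldl (sweepStep τ) (v, L)).2
          right := [] } (4 * R.length + 1) := by
    intro R
    induction R with
    | nil =>
        intro L v hv
        simp only [List.head?_nil, Reg.setCell_none hv]
        exact Run.loopFalse (by simp [hv])
    | cons e R ih =>
        intro L v hv
        refine Run.mono (Run.loopTrue rfl (Run.seq (Run.load _) (Run.seq (Run.pushLeft _)
          (Run.popRight _))) (u := 4 * R.length + 1) ?_) (by simp only [List.length_cons]; omega)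
        have h := ih ((τ v e).2 :: L) (τ v e).1 (hτ v e hv)
        simpa [Reg.transduce, Reg.getCell, Reg.setCell, Reg.setCell_none hv, sweepStep] using h
  exact Run.mono (Run.seq (Run.popRight _) (key m.right m.left m.v hm)) (by omega)

include hτ in
theorem run_sweepLeft (m : Mem arity) (hm : m.v.cell = none) :
    Run (sweepLeft τ) m
      { m with
        v := (m.left.foldl (sweepStep τ) (m.v, m.right)).1
        right := (m.left.foldl (sweepStep τ) (m.v, m.right)).2
        left := [] } (4 * m.left.length + 2) := by
  have key : ∀ (R L : List (Cell arity)) (v : Reg arity), v.cell = none →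
      Run (.loop (fun v => v.cell.isSome) <|
        (Cmd.load (Reg.transduce τ)).seq <| (Prog.push .right Reg.getCell).seq <|
        Prog.pop .left Reg.setCell)
        { m with v := { v with cell := R.head? }, left := R.tail, right := L }
        { m with
          v := (R.foldl (sweepStep τ) (v, L)).1
          right := (R.foldl (sweepStep τ) (v, L)).2
          left := [] } (4 * R.length + 1) := by
    intro R
    induction R with
    | nil =>
        intro L v hv
        simp only [List.head?_nil, Reg.setCell_none hv]
        exact Run.loopFalse (by simp [hv])
    | cons e R ih =>
        intro L v hv
        refine Run.mono (Run.loopTrue rfl (Run.seq (Run.load _) (Run.seq (Run.pushRight _)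
          (Run.popLeft _))) (u := 4 * R.length + 1) ?_) (by simp only [List.length_cons]; omega)
        have h := ih ((τ v e).2 :: L) (τ v e).1 (hτ v e hv)
        simpa [Reg.transduce, Reg.getCell, Reg.setCell, Reg.setCell_none hv, sweepStep] using h
  exact Run.mono (Run.seq (Run.popLeft _) (key m.left m.right m.v hm)) (by omega)

end Sweep

/-- The entry of a cell after the reduction by the noted entry of another row, if it is required. -/
def Cell.merge (f : Bool) (e : Cell arity) : Cell arity :=
  { e with p := bif f then e.p.mul e.q else e.p, q := .I }

/-- The phase that arises in `Cell.merge`. -/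
def Cell.twist (f : Bool) (e : Cell arity) : ZMod 4 := bif f then e.p.phase e.q else 0

/-- The transducer that reduces a row. -/
def mergeTrans (v : Reg arity) (e : Cell arity) : Reg arity × Cell arity :=
  ({ v with phase := v.phase + e.twist v.flag }, e.merge v.flag)

open Classical in
/-- Note the entry of a marked cell. -/
noncomputable def Cell.collect (f : Slot arity → Pauli) (e : Cell arity) : Slot arity → Pauli :=
  match e.slot with
  | some s => Function.update f s e.p
  | none => f

/-- Replace the entry of a marked cell. -/
def Cell.replace (f : Slot arity → Pauli) (e : Cell arity) : Cell arity :=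
  match e.slot with
  | some s => { e with p := f s, slot := none }
  | none => e

/-- The transducer that notes the entries of the marked cells. -/
noncomputable def collectTrans (v : Reg arity) (e : Cell arity) : Reg arity × Cell arity :=
  ({ v with vals := e.collect v.vals }, e)

/-- The transducer that replaces the entries of the marked cells. -/
def replaceTrans (v : Reg arity) (e : Cell arity) : Reg arity × Cell arity :=
  (v, e.replace v.vals)

theorem foldl_mergeTrans (L : List (Cell arity)) : ∀ (v : Reg arity) (R : List (Cell arity)),
    L.foldl (sweepStep mergeTrans) (v, R) =
      ({ v with phase := v.phase + (L.map (Cell.twist v.flag)).sum },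
        (L.map (Cell.merge v.flag)).reverse ++ R) := by
  induction L with
  | nil => simp
  | cons e L ih =>
      intro v R
      simp [sweepStep, mergeTrans, ih, add_assoc]

theorem foldl_collectTrans (R : List (Cell arity)) : ∀ (v : Reg arity) (L : List (Cell arity)),
    R.foldl (sweepStep collectTrans) (v, L) =
      ({ v with vals := R.foldl Cell.collect v.vals }, R.reverse ++ L) := by
  induction R with
  | nil => simp
  | cons e L ih =>
      intro v R
      simp [sweepStep, collectTrans, ih]

theorem foldl_replaceTrans (L : List (Cell arity)) (v : Reg arity) :
    ∀ R : List (Cell arity), L.foldl (sweepStep replaceTrans) (v, R) =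
      (v, (L.map (Cell.replace v.vals)).reverse ++ R) := by
  induction L with
  | nil => simp
  | cons e L ih =>
      intro R
      simp [sweepStep, replaceTrans, ih]

/-! ### Instructions -/

/-- A row with a position in it. -/
structure Zip (arity : G → ℕ) : Type where
  phase : ZMod 4
  flag : Bool
  left : List (Cell arity)
  right : List (Cell arity)

/-- Return to the first cell of the row, and reduce the row if the flag is set. -/
def Zip.rewind (z : Zip arity) : Zip arity :=
  ⟨z.phase + (z.left.map (Cell.twist z.flag)).sum, false, [],
    (z.left.map (Cell.merge z.flag)).reverse ++ z.right⟩

/-- The number of cells of a row. -/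
def Zip.size (z : Zip arity) : ℕ := z.left.length + z.right.length

/-- For each gate and each product of Pauli matrices at its places, the phase and the product of
Pauli matrices that result by conjugation. -/
abbrev Table (arity : G → ℕ) : Type := G → (Slot arity → Pauli) → ZMod 4 × (Slot arity → Pauli)

/-- The effect of an instruction. -/
noncomputable def Instr.act (T : Table arity) : Instr arity → Zip arity → Zip arity
  | .entry p, z =>
      match z.right with
      | [] => z
      | e :: r => ⟨z.phase, bif p.hasX then e.p.hasX else z.flag, { e with q := p } :: z.left, r⟩
  | .mark s, z =>
      Zip.rewind { z with right := z.right.modifyHead fun e => { e with slot := some s } }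
  | .gate g, z =>
      ⟨z.phase + (T g (z.right.foldl Cell.collect fun _ => .I)).1, z.flag, [],
        ((z.right.reverse ++ z.left).map
          (Cell.replace (T g (z.right.foldl Cell.collect fun _ => .I)).2)).reverse⟩
  | .finish c, z => Zip.rewind { z with phase := z.phase + bif z.flag then c else 0 }

theorem Zip.size_rewind (z : Zip arity) : z.rewind.size = z.size := by
  simp [Zip.rewind, Zip.size]

/-- As the length of the row never changes, one time bound serves for every instruction of a list.
-/
theorem Instr.size_act (T : Table arity) (i : Instr arity) (z : Zip arity) :
    (i.act T z).size = z.size := by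
  cases i with
  | entry p =>
      rcases h : z.right with _ | ⟨e, r⟩
      · simp [Instr.act, h]
      · simp [Instr.act, h, Zip.size]
        omega
  | mark s =>
      rw [Instr.act, Zip.size_rewind]
      simp [Zip.size]
  | gate g =>
      simp [Instr.act, Zip.size]
  | finish c =>
      rw [Instr.act, Zip.size_rewind]
      simp [Zip.size]

/-- Write a row into the memory. -/
def Mem.put (m : Mem arity) (z : Zip arity) : Mem arity :=
  { m with
    v := { m.v with phase := z.phase, flag := z.flag }
    left := z.left
    right := z.right }

/-- Return to the first cell of the row, and reduce the row if the flag is set. -/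
def rewind : Prog arity :=
  (sweepLeft mergeTrans).seq <| .load fun v => { v with flag := false }

theorem run_rewind (m : Mem arity) (hm : m.v.cell = none) (z : Zip arity) :
    Run rewind (m.put z) (m.put z.rewind) (4 * z.left.length + 3) := by
  have h := run_sweepLeft (τ := mergeTrans) (fun v e hv => hv) (m.put z) hm
  rw [foldl_mergeTrans] at h
  exact h.seq (Run.load _)

/-- The program for the instruction `Instr.entry`. -/
def entryProg : Prog arity :=
  (Prog.pop .right Reg.setCell).seq <| .ite (fun v => v.cell.isSome)
    ((Cmd.load fun v => match v.ins with
      | some (.entry p) =>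
          { v with
            flag := bif p.hasX then v.getCell.p.hasX else v.flag
            cell := some { v.getCell with q := p } }
      | _ => v).seq <|
    (Prog.push .left Reg.getCell).seq <| .load fun v => v.setCell none) (.load id)

/-- The program for the instruction `Instr.mark`. -/
def markProg : Prog arity :=
  (Prog.pop .right Reg.setCell).seq <| (Cmd.ite (fun v => v.cell.isSome)
    ((Prog.push .right fun v => match v.ins with
      | some (.mark s) => { v.getCell with slot := some s }
      | _ => v.getCell).seq <| .load fun v => v.setCell none) (.load id)).seq rewind

/-- The program for the instruction `Instr.gate`. -/
noncomputable def gateProg (T : Table arity) : Prog arity :=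
  (sweepRight collectTrans).seq <| (Cmd.load fun v => match v.ins with
    | some (.gate g) => { v with phase := v.phase + (T g v.vals).1, vals := (T g v.vals).2 }
    | _ => v).seq <| (sweepLeft replaceTrans).seq <| .load fun v => { v with vals := fun _ => .I }

/-- The program for the instruction `Instr.finish`. -/
def finishProg : Prog arity :=
  (Cmd.load fun v => match v.ins with
    | some (.finish c) => { v with phase := v.phase + bif v.flag then c else 0 }
    | _ => v).seq rewind

/-- The program for one instruction, which is found in the register. -/
noncomputable def instrProg (T : Table arity) : Prog arity :=
  .ite (fun v => match v.ins with | some (.entry _) => true | _ => false) entryProg <|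
  .ite (fun v => match v.ins with | some (.mark _) => true | _ => false) markProg <|
  .ite (fun v => match v.ins with | some (.gate _) => true | _ => false) (gateProg T) finishProg

/-- No instruction needs more than two sweeps of four steps per cell. The worst case is a gate: one
sweep to the right collects the entries at its places, and one back to the left replaces them. -/
theorem run_instrProg (T : Table arity) (i : Instr arity) (m : Mem arity) (hc : m.v.cell = none)
    (hv : m.v.vals = fun _ => .I) (hi : m.v.ins = some i) (z : Zip arity) :
    Run (instrProg T) (m.put z) (m.put (i.act T z)) (8 * z.size + 12) := by
  obtain ⟨⟨sym, ins, cell, cur, vals, phase, flag, hasX, found, fail⟩, inp, out, ins', done, R, L⟩ :=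
    m
  simp only at hc hv hi
  subst hc hv hi
  obtain ⟨c, f, L, R⟩ := z
  cases i with
  | entry p =>
      cases R with
      | nil =>
          exact Run.mono (Run.iteTrue rfl (Run.seq (Run.popRight _)
            (Run.iteFalse rfl (Run.load _)))) (by omega)
      | cons e R =>
          exact Run.mono (Run.iteTrue rfl (Run.seq (Run.popRight _) (Run.iteTrue rfl
            (Run.seq (Run.load _) (Run.seq (Run.pushLeft _) (Run.load _)))))) (by omega)
  | mark s =>
      cases R with
      | nil =>
          exact Run.mono (Run.iteFalse rfl (Run.iteTrue rfl (Run.seq (Run.popRight _)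
            (Run.seq (Run.iteFalse rfl (Run.load _))
            (run_rewind ⟨⟨sym, _, none, cur, _, phase, flag, hasX, found, fail⟩, inp, out, ins',
              done, [], []⟩ rfl ⟨c, f, L, []⟩))))) (by simp only [Zip.size]; omega)
      | cons e R =>
          exact Run.mono (Run.iteFalse rfl (Run.iteTrue rfl (Run.seq (Run.popRight _)
            (Run.seq (Run.iteTrue rfl (Run.seq (Run.pushRight _) (Run.load _)))
            (run_rewind ⟨⟨sym, _, none, cur, _, phase, flag, hasX, found, fail⟩, inp, out, ins',
              done, [], []⟩ rfl ⟨c, f, L, { e with slot := some s } :: R⟩)))))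
              (by simp only [Zip.size]; omega)
  | gate g =>
      have h₁ := run_sweepRight (τ := collectTrans) (fun v e hv => hv)
        (Mem.put (⟨⟨sym, some (.gate g), none, cur, fun _ => .I, phase, flag, hasX, found, fail⟩,
          inp, out, ins', done, [], []⟩ : Mem arity) ⟨c, f, L, R⟩) rfl
      rw [foldl_collectTrans] at h₁
      have h₂ := run_sweepLeft (τ := replaceTrans (arity := arity)) (fun v e hv => hv)
        ⟨⟨sym, some (.gate g), none, cur, (T g (R.foldl Cell.collect fun _ => .I)).2,
          c + (T g (R.foldl Cell.collect fun _ => .I)).1, f, hasX, found, fail⟩,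
          inp, out, ins', done, [], R.reverse ++ L⟩ rfl
      rw [foldl_replaceTrans, List.append_nil] at h₂
      exact Run.mono (Run.iteFalse rfl (Run.iteFalse rfl (Run.iteTrue rfl (Run.seq h₁
        (Run.seq (Run.load _) (Run.seq h₂ (Run.load _)))))))
        (by simp only [Zip.size, Mem.put, List.length_append, List.length_reverse]; omega)
  | finish c' =>
      exact Run.mono (Run.iteFalse rfl (Run.iteFalse rfl (Run.iteFalse rfl
        (Run.seq (Run.load _) (run_rewind ⟨⟨sym, some (.finish c'), none, cur, _, phase, flag, hasX,
        found, fail⟩, inp, out, ins', done, [], []⟩ rfl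
        ⟨c + bif f then c' else 0, f, L, R⟩))))) (by simp only [Zip.size]; omega)

end

section

variable {G : Type} {arity : G → ℕ}

/-! ### The main program -/

/-- Store an instruction in the register. -/
def Reg.setIns (v : Reg arity) (o : Option (Instr arity)) : Reg arity := { v with ins := o }

/-- The instruction in the register. -/
def Reg.getIns (v : Reg arity) : Instr arity := v.ins.getD default

/-- The register holds no intermediate results. -/
structure Reg.Idle (v : Reg arity) : Prop where
  ins : v.ins = none
  cell : v.cell = none
  vals : v.vals = fun _ => .I

/-- Execute all instructions. -/
noncomputable def execProg (T : Table arity) : Prog arity :=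
  (Prog.pop .ins Reg.setIns).seq <| .loop (fun v => v.ins.isSome) <|
    (Prog.push .done Reg.getIns).seq <| (instrProg T).seq <| Prog.pop .ins Reg.setIns

theorem run_execProg (T : Table arity) (m : Mem arity) (hm : m.v.Idle) (z : Zip arity) :
    Run (execProg T) (m.put z)
      (Mem.put { m with ins := [], done := m.ins.reverse ++ m.done }
        (m.ins.foldl (fun z i => i.act T z) z)) (m.ins.length * (8 * z.size + 15) + 2) := by
  obtain ⟨⟨sym, ins, cell, cur, vals, phase, flag, hasX, found, fail⟩, inp, out, I, D, R, L⟩ := m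
  obtain ⟨hi, hc, hv⟩ := hm
  simp only at hi hc hv
  subst hi hc hv
  have key : ∀ (I D : List (Instr arity)) (z : Zip arity),
      Run (.loop (fun v => v.ins.isSome) <|
        (Prog.push .done Reg.getIns).seq <| (instrProg T).seq <| Prog.pop .ins Reg.setIns)
        (Mem.put ⟨⟨sym, I.head?, none, cur, fun _ => .I, phase, flag, hasX, found, fail⟩, inp, out,
          I.tail, D, R, L⟩ z)
        (Mem.put ⟨⟨sym, none, none, cur, fun _ => .I, phase, flag, hasX, found, fail⟩, inp, out,
          [], I.reverse ++ D, R, L⟩ (I.foldl (fun z i => i.act T z) z))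
        (I.length * (8 * z.size + 15) + 1) := by
    intro I
    induction I with
    | nil =>
        intro D z
        exact Run.mono (Run.loopFalse rfl) (by omega)
    | cons i I ih =>
        intro D z
        have h := ih (i :: D) (i.act T z)
        rw [Instr.size_act] at h
        simp only [List.reverse_cons, List.append_assoc, List.singleton_append, List.foldl_cons]
        refine Run.mono (Run.loopTrue rfl (Run.seq (Run.pushDone _) (Run.seq (run_instrProg T i
          ⟨⟨sym, some i, none, cur, fun _ => .I, phase, flag, hasX, found, fail⟩, inp, out, I,
            i :: D, R, L⟩ rfl rfl rfl z) (Run.popIns _))) h) ?_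
        rw [List.length_cons, Nat.add_mul]
        omega
  exact Run.mono (Run.seq (Run.popIns _) (key I D z)) (by simp only; omega)

/-- Make the executed instructions available again. -/
def restoreProg : Prog arity :=
  (Prog.pop .done Reg.setIns).seq <| .loop (fun v => v.ins.isSome) <|
    (Prog.push .ins Reg.getIns).seq <| Prog.pop .done Reg.setIns

theorem run_restoreProg (m : Mem arity) (hm : m.v.ins = none) :
    Run restoreProg m { m with ins := m.done.reverse ++ m.ins, done := [] }
      (3 * m.done.length + 2) := by
  obtain ⟨⟨sym, ins, cell, cur, vals, phase, flag, hasX, found, fail⟩, inp, out, I, D, R, L⟩ := m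
  simp only at hm
  subst hm
  have key : ∀ D I : List (Instr arity),
      Run (.loop (fun v => v.ins.isSome) <|
        (Prog.push .ins Reg.getIns).seq <| Prog.pop .done Reg.setIns)
        (⟨⟨sym, D.head?, cell, cur, vals, phase, flag, hasX, found, fail⟩, inp, out,
          I, D.tail, R, L⟩ : Mem arity)
        ⟨⟨sym, none, cell, cur, vals, phase, flag, hasX, found, fail⟩, inp, out,
          D.reverse ++ I, [], R, L⟩ (3 * D.length + 1) := by
    intro D
    induction D with
    | nil =>
        intro I
        exact Run.mono (Run.loopFalse rfl) (by omega)
    | cons i D ih =>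
        intro I
        simp only [List.reverse_cons, List.append_assoc, List.singleton_append]
        exact Run.mono (Run.loopTrue rfl (Run.seq (Run.pushIns _) (Run.popDone _)) (ih (i :: I)))
          (by rw [List.length_cons]; omega)
  exact Run.mono (Run.seq (Run.popDone _) (key D I)) (by simp only; omega)

/-- Append the current row to the instructions, and take it into account in the result. -/
def recordProg : Prog arity :=
  (Prog.pop .right Reg.setCell).seq <|
  (Cmd.loop (fun v => v.cell.isSome) <|
    (Cmd.load fun v => { v with hasX := v.hasX || v.getCell.p.hasX }).seq <|
    (Prog.push .done fun v => .entry v.getCell.p).seq <|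
    (Prog.push .left Reg.getCell).seq <| Prog.pop .right Reg.setCell).seq <|
  (Prog.push .done fun v => .finish v.phase).seq <|
  rewind.seq <|
  .ite (fun v => v.hasX) (Prog.push .out fun _ => some false)
    (.load fun v => { v with fail := v.fail || !decide (v.phase = 0) })

/-- The row is stored as instructions behind those already executed, so later replays reduce by it
after the circuit. A row that flips a qubit contributes a factor 1/2, that is, a binary digit 0 of
the denominator; a row without flips and with nonzero phase makes the outcomes impossible. -/
theorem run_recordProg (m : Mem arity) (hc : m.v.cell = none) (hX : m.v.hasX = false)
    (hf : m.v.flag = false) (hl : m.left = []) :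
    Run recordProg m
      { m with
        v := { m.v with
          hasX := m.right.any fun e => e.p.hasX
          fail := m.v.fail || (!(m.right.any fun e => e.p.hasX) && !decide (m.v.phase = 0)) }
        done := .finish m.v.phase :: ((m.right.map fun e => Instr.entry e.p).reverse ++ m.done)
        right := m.right.map (Cell.merge false)
        out := bif m.right.any fun e => e.p.hasX then some false :: m.out else m.out }
      (9 * m.right.length + 8) := by
  obtain ⟨⟨sym, ins, cell, cur, vals, phase, flag, hasX, found, fail⟩, inp, out, I, D, R, L⟩ := m
  simp only at hc hX hf hl
  subst hc hX hf hl
  have key : ∀ (R L : List (Cell arity)) (D : List (Instr arity)) (hasX : Bool),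
      Run (Cmd.loop (fun v => v.cell.isSome) <|
        (Cmd.load fun v => { v with hasX := v.hasX || v.getCell.p.hasX }).seq <|
        (Prog.push .done fun v => .entry v.getCell.p).seq <|
        (Prog.push .left Reg.getCell).seq <| Prog.pop .right Reg.setCell)
        (⟨⟨sym, ins, R.head?, cur, vals, phase, false, hasX, found, fail⟩, inp, out,
          I, D, R.tail, L⟩ : Mem arity)
        ⟨⟨sym, ins, none, cur, vals, phase, false, hasX || R.any fun e => e.p.hasX, found, fail⟩,
          inp, out, I, (R.map fun e => Instr.entry e.p).reverse ++ D, [], R.reverse ++ L⟩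
          (5 * R.length + 1) := by
    intro R
    induction R with
    | nil =>
        intro L D hasX
        simp only [List.any_nil, Bool.or_false]
        exact Run.mono (Run.loopFalse rfl) (by omega)
    | cons e R ih =>
        intro L D hasX
        have h := ih (e :: L) (.entry e.p :: D) (hasX || e.p.hasX)
        simp only [List.any_cons, ← Bool.or_assoc, List.reverse_cons, List.append_assoc,
          List.singleton_append, List.map_cons]
        exact Run.mono (Run.loopTrue rfl (Run.seq (Run.load _) (Run.seq (Run.pushDone _)
          (Run.seq (Run.pushLeft _) (Run.popRight _)))) h) (by rw [List.length_cons]; omega)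
  have h₁ := key R [] D false
  simp only [Bool.false_or, List.append_nil] at h₁
  have h₂ := run_rewind ⟨⟨sym, ins, none, cur, vals, phase, false, R.any fun e => e.p.hasX, found,
    fail⟩, inp, out, I, .finish phase :: ((R.map fun e => Instr.entry e.p).reverse ++ D), [], []⟩
    rfl ⟨phase, false, R.reverse, []⟩
  -- The flag is not set, so the return only moves the cells back.
  have h₃ : (Zip.mk phase false R.reverse []).rewind =
      ⟨phase, false, [], R.map (Cell.merge false)⟩ := by
    have : (R.map fun e => Cell.twist false e).sum = 0 := by
      simp [Cell.twist]
    simp [Zip.rewind, List.sum_reverse, this]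
  rw [h₃] at h₂
  refine Run.mono (Run.seq (Run.popRight _) (Run.seq h₁ (Run.seq (Run.pushDone _)
    (Run.seq h₂ (u := 2) ?_)))) (by simp only [List.length_reverse]; omega)
  cases hX : R.any fun e => e.p.hasX with
  | true =>
      refine Run.iteTrue rfl ?_
      simp only [Bool.not_true, Bool.false_and, Bool.or_false]
      exact Run.pushOut _
  | false => exact Run.iteFalse rfl (Run.load _)

/-! ### Preparing the row of the next requested outcome -/

/-- A cell with the identity as its entry. -/
def Cell.reset (e : Cell arity) : Cell arity := ⟨.I, .I, none, e.out⟩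

/-- Find the first requested outcome, and prepare the row that belongs to it. -/
def pick : List (Cell arity) → Option (Fin 2) × List (Cell arity)
  | [] => (none, [])
  | e :: R =>
      match e.out with
      | some b => (some b, ⟨.Z, .I, none, none⟩ :: R.map Cell.reset)
      | none => ((pick R).1, e.reset :: (pick R).2)

/-- The phase of the row that belongs to a requested outcome. -/
def outcomePhase : Option (Fin 2) → ZMod 4
  | some 1 => 2
  | _ => 0

/-- The transducer that prepares the next row. -/
def pickTrans (v : Reg arity) (e : Cell arity) : Reg arity × Cell arity :=
  if v.found then (v, e.reset) else
    match e.out with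
    | some b => ({ v with found := true, phase := outcomePhase (some b) }, ⟨.Z, .I, none, none⟩)
    | none => (v, e.reset)

theorem foldl_pickTrans_of_found (R : List (Cell arity)) (v : Reg arity) (hv : v.found = true) :
    ∀ L, R.foldl (sweepStep pickTrans) (v, L) = (v, (R.map Cell.reset).reverse ++ L) := by
  induction R with
  | nil => simp
  | cons e R ih =>
      intro L
      simp [sweepStep, pickTrans, hv, ih]

/-- The phase has to start at 0 for the case in which no outcome is found, where it is left as it
was. -/
theorem foldl_pickTrans (R : List (Cell arity)) (v : Reg arity) (hv : v.found = false)
    (hp : v.phase = 0) :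
    ∀ L, R.foldl (sweepStep pickTrans) (v, L) =
      ({ v with found := (pick R).1.isSome, phase := outcomePhase (pick R).1 },
        (pick R).2.reverse ++ L) := by
  induction R with
  | nil =>
      cases v
      simp_all [pick, outcomePhase]
  | cons e R ih =>
      intro L
      cases h : e.out with
      | none => simp [sweepStep, pickTrans, hv, h, ih, pick]
      | some b => simp [sweepStep, pickTrans, hv, h, pick, foldl_pickTrans_of_found]

theorem map_merge_pick (R : List (Cell arity)) :
    (pick R).2.map (Cell.merge false) = (pick R).2 := by
  induction R with
  | nil => rfl
  | cons e R ih =>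
      cases h : e.out with
      | none => simpa [pick, h, Cell.merge, Cell.reset] using ih
      | some b => simp [pick, h, Cell.merge, Cell.reset]

/-- Prepare the next row. -/
def pickProg : Prog arity :=
  (Cmd.load fun v => { v with found := false, phase := 0, hasX := false }).seq <|
    (sweepRight pickTrans).seq rewind

theorem run_pickProg (m : Mem arity) (hc : m.v.cell = none) (hf : m.v.flag = false)
    (hl : m.left = []) :
    Run pickProg m
      { m with
        v := { m.v with
          found := (pick m.right).1.isSome
          phase := outcomePhase (pick m.right).1
          hasX := false }
        right := (pick m.right).2 } (8 * m.right.length + 6) := by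
  obtain ⟨⟨sym, ins, cell, cur, vals, phase, flag, hasX, found, fail⟩, inp, out, I, D, R, L⟩ := m
  simp only at hc hf hl
  subst hc hf hl
  have h₁ := run_sweepRight (τ := pickTrans) (fun v e hv => by
      unfold pickTrans
      split_ifs
      · exact hv
      · cases e.out <;> exact hv)
    (⟨⟨sym, ins, none, cur, vals, 0, false, false, false, fail⟩, inp, out, I, D, R, []⟩ : Mem arity)
    rfl
  rw [foldl_pickTrans _ _ rfl rfl, List.append_nil] at h₁
  have h₂ := run_rewind ⟨⟨sym, ins, none, cur, vals, 0, false, false, (pick R).1.isSome,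
    fail⟩, inp, out, I, D, [], []⟩ rfl ⟨outcomePhase (pick R).1, false, (pick R).2.reverse, []⟩
  have h₃ : (Zip.mk (outcomePhase (pick R).1) false (pick R).2.reverse []).rewind =
      ⟨outcomePhase (pick R).1, false, [], (pick R).2⟩ := by
    have : ((pick R).2.map fun e => Cell.twist false e).sum = 0 := by
      simp [Cell.twist]
    simp [Zip.rewind, List.sum_reverse, this, map_merge_pick]
  have h₄ : (pick R).2.length = R.length := by
    clear h₁ h₂ h₃
    induction R with
    | nil => rfl
    | cons e R ih =>
        cases h : e.out with
        | none => simpa [pick, h] using ih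
        | some b => simp [pick, h]
  rw [h₃] at h₂
  exact Run.mono (Run.seq (Run.load _) (Run.seq h₁ h₂))
    (by simp only [List.length_reverse, h₄]; omega)

/-! ### Reading the input -/

/-- The first place of a gate. -/
def firstSlot (g : G) : Option (Slot arity) :=
  if h : 0 < arity g then some ⟨g, 0, h⟩ else none

/-- The next place of a gate. -/
def nextSlot (s : Slot arity) : Option (Slot arity) :=
  if h : s.2.1 + 1 < arity s.1 then some ⟨s.1, s.2.1 + 1, h⟩ else none

/-- What is known after a part of the input has been read: the place of the gate to which the next
index belongs, the instructions for the circuit, and the cells of the qubits. -/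
structure Reading (arity : G → ℕ) : Type where
  cur : Option (Slot arity)
  ins : List (Instr arity)
  cells : List (Cell arity)

/-- The effect of one symbol of the input. -/
def Reading.read (r : Reading arity) : Sym G → Reading arity
  | .outcome b => { r with cells := ⟨.I, .I, none, b⟩ :: r.cells }
  | .tick => { r with ins := .entry .I :: r.ins }
  | .gate g => ⟨firstSlot g, (firstSlot g).toList.map .mark ++ .gate g :: r.ins, r.cells⟩
  | .endIndex =>
      ⟨r.cur.bind nextSlot, (r.cur.bind nextSlot).toList.map .mark ++ r.ins, r.cells⟩

/-- Store a symbol of the input in the register. -/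
def Reg.setSym (v : Reg arity) (o : Option (Sym G)) : Reg arity := { v with sym := o }

/-- Read one symbol of the input. -/
def symProg : Prog arity :=
  .ite (fun v => match v.sym with | some (.outcome _) => true | _ => false)
    (Prog.push .left fun v => match v.sym with
      | some (.outcome b) => ⟨.I, .I, none, b⟩
      | _ => default) <|
  .ite (fun v => match v.sym with | some .tick => true | _ => false)
    (Prog.push .ins fun _ => .entry .I) <|
  (Cmd.ite (fun v => match v.sym with | some (.gate _) => true | _ => false)
    (Prog.push .ins fun v => match v.sym with
      | some (.gate g) => .gate g
      | _ => default) (.load id)).seq <|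
  (Cmd.load fun v => { v with
    cur := match v.sym with
      | some (.gate g) => firstSlot g
      | _ => v.cur.bind nextSlot }).seq <|
  .ite (fun v => v.cur.isSome)
    (Prog.push .ins fun v => match v.cur with
      | some s => .mark s
      | none => default) (.load id)

/-- Read the input. -/
def readProg : Prog arity :=
  (Prog.pop .inp Reg.setSym).seq <| .loop (fun v => v.sym.isSome) <|
    symProg.seq <| Prog.pop .inp Reg.setSym

/-- Write what is known about the input into the memory. -/
def Mem.putReading (m : Mem arity) (r : Reading arity) : Mem arity :=
  { m with v := { m.v with cur := r.cur }, ins := r.ins, left := r.cells }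

theorem run_symProg (m : Mem arity) (r : Reading arity) (s : Sym G) (hs : m.v.sym = some s) :
    Run symProg (m.putReading r) (m.putReading (r.read s)) 7 := by
  obtain ⟨⟨sym, ins, cell, cur, vals, phase, flag, hasX, found, fail⟩, inp, out, I, D, R, L⟩ := m
  simp only at hs
  subst hs
  have hcur : ∀ (o : Option (Slot arity)) (I : List (Instr arity)),
      Run (Cmd.ite (fun v => v.cur.isSome) (Prog.push .ins fun v => match v.cur with
        | some s => .mark s
        | none => default) (.load id))
        (⟨⟨some s, ins, cell, o, vals, phase, flag, hasX, found, fail⟩, inp, out, I, D, R,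
          r.cells⟩ : Mem arity)
        ⟨⟨some s, ins, cell, o, vals, phase, flag, hasX, found, fail⟩, inp, out,
          o.toList.map .mark ++ I, D, R, r.cells⟩ 2 := by
    intro o I
    cases o with
    | none => exact Run.iteFalse rfl (Run.load _)
    | some s => exact Run.iteTrue rfl (Run.pushIns _)
  cases s with
  | outcome b => exact Run.mono (Run.iteTrue rfl (Run.pushLeft _)) (by omega)
  | tick => exact Run.mono (Run.iteFalse rfl (Run.iteTrue rfl (Run.pushIns _))) (by omega)
  | gate g =>
      exact Run.mono (Run.iteFalse rfl (Run.iteFalse rfl (Run.seq (Run.iteTrue rfl (Run.pushIns _))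
        (Run.seq (Run.load _) (hcur _ _))))) (by omega)
  | endIndex =>
      exact Run.mono (Run.iteFalse rfl (Run.iteFalse rfl (Run.seq (Run.iteFalse rfl (Run.load _))
        (Run.seq (Run.load _) (hcur _ _))))) (by omega)

theorem run_readProg (m : Mem arity) (hm : m.v.sym = none) (r : Reading arity) :
    Run readProg (m.putReading r)
      (Mem.putReading { m with inp := [] } (m.inp.foldl Reading.read r))
      (9 * m.inp.length + 2) := by
  obtain ⟨⟨sym, ins, cell, cur, vals, phase, flag, hasX, found, fail⟩, N, out, I, D, R, L⟩ := m
  simp only at hm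
  subst hm
  have key : ∀ (N : List (Sym G)) (r : Reading arity),
      Run (.loop (fun v => v.sym.isSome) <| symProg.seq <| Prog.pop .inp Reg.setSym)
        (Mem.putReading ⟨⟨N.head?, ins, cell, cur, vals, phase, flag, hasX, found, fail⟩, N.tail,
          out, I, D, R, L⟩ r)
        (Mem.putReading ⟨⟨none, ins, cell, cur, vals, phase, flag, hasX, found, fail⟩, [],
          out, I, D, R, L⟩ (N.foldl Reading.read r))
        (9 * N.length + 1) := by
    intro N
    induction N with
    | nil =>
        intro r
        exact Run.mono (Run.loopFalse rfl) (by omega)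
    | cons s N ih =>
        intro r
        exact Run.mono (Run.loopTrue rfl (Run.seq (run_symProg ⟨⟨some s, ins, cell, cur, vals,
          phase, flag, hasX, found, fail⟩, N, out, I, D, R, L⟩ r s rfl) (Run.popInp _))
          (ih (r.read s))) (by rw [List.length_cons]; omega)
  exact Run.mono (Run.seq (Run.popInp _) (key N r)) (by simp only; omega)

/-! ### Writing the output -/

/-- Note whether a stack was empty. -/
def Reg.setFlag {α : Type} (v : Reg arity) (o : Option α) : Reg arity := { v with flag := o.isSome }

/-- Empty a stack. -/
def clearProg (k : Stk) : Prog arity :=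
  (Prog.pop k Reg.setFlag).seq <| .loop (fun v => v.flag) <| Prog.pop k Reg.setFlag

theorem run_clearProg_right (m : Mem arity) :
    Run (clearProg .right) m { m with v := { m.v with flag := false }, right := [] }
      (2 * m.right.length + 2) := by
  have key : ∀ R : List (Cell arity),
      Run (.loop (fun v => v.flag) <| Prog.pop .right Reg.setFlag)
        { m with v := { m.v with flag := R.head?.isSome }, right := R.tail }
        { m with v := { m.v with flag := false }, right := [] } (2 * R.length + 1) := by
    intro R
    induction R with
    | nil => exact Run.mono (Run.loopFalse rfl) (by omega)
    | cons e R ih =>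
        exact Run.mono (Run.loopTrue rfl (Run.popRight _) ih) (by rw [List.length_cons]; omega)
  exact Run.mono (Run.seq (Run.popRight _) (key m.right)) (by omega)

theorem run_clearProg_ins (m : Mem arity) :
    Run (clearProg .ins) m { m with v := { m.v with flag := false }, ins := [] }
      (2 * m.ins.length + 2) := by
  have key : ∀ I : List (Instr arity),
      Run (.loop (fun v => v.flag) <| Prog.pop .ins Reg.setFlag)
        { m with v := { m.v with flag := I.head?.isSome }, ins := I.tail }
        { m with v := { m.v with flag := false }, ins := [] } (2 * I.length + 1) := by
    intro I
    induction I with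
    | nil => exact Run.mono (Run.loopFalse rfl) (by omega)
    | cons e I ih =>
        exact Run.mono (Run.loopTrue rfl (Run.popIns _) ih) (by rw [List.length_cons]; omega)
  exact Run.mono (Run.seq (Run.popIns _) (key m.ins)) (by omega)

theorem run_clearProg_out (m : Mem arity) :
    Run (clearProg .out) m { m with v := { m.v with flag := false }, out := [] }
      (2 * m.out.length + 2) := by
  have key : ∀ O : List (Option Bool),
      Run (.loop (fun v => v.flag) <| Prog.pop .out Reg.setFlag)
        { m with v := { m.v with flag := O.head?.isSome }, out := O.tail }
        { m with v := { m.v with flag := false }, out := [] } (2 * O.length + 1) := by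
    intro O
    induction O with
    | nil => exact Run.mono (Run.loopFalse rfl) (by omega)
    | cons e O ih =>
        exact Run.mono (Run.loopTrue rfl (Run.popOut _) ih) (by rw [List.length_cons]; omega)
  exact Run.mono (Run.seq (Run.popOut _) (key m.out)) (by omega)

/-- Complete the output, and clean up. -/
def writeProg : Prog arity :=
  (clearProg .right).seq <| (clearProg .ins).seq <|
  (Cmd.ite (fun v => v.fail)
    ((clearProg .out).seq <| (Prog.push .out fun _ => some true).seq <|
      Prog.push .out fun _ => none)
    ((Prog.push .out fun _ => none).seq <| Prog.push .out fun _ => some true)).seq <|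
  .load fun _ => Reg.init arity

/-- The two pushed symbols put the numerator 1 and the separator in front of the denominator. For
probability 0 the numerator is the empty string, and the denominator is 1. -/
theorem run_writeProg (m : Mem arity) (hi : m.inp = []) (hd : m.done = []) (hl : m.left = []) :
    Run writeProg m
      ⟨Reg.init arity, [],
        bif m.v.fail then [none, some true] else some true :: none :: m.out, [], [], [], []⟩
      (2 * m.right.length + 2 * m.ins.length + 2 * m.out.length + 10) := by
  obtain ⟨⟨sym, ins, cell, cur, vals, phase, flag, hasX, found, fail⟩, inp, out, I, D, R, L⟩ := m
  simp only at hi hd hl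
  subst hi hd hl
  cases fail with
  | true =>
      exact Run.mono (Run.seq (run_clearProg_right _) (Run.seq (run_clearProg_ins _) (Run.seq
        (Run.iteTrue rfl (Run.seq (run_clearProg_out _) (Run.seq (Run.pushOut _) (Run.pushOut _))))
        (Run.load _)))) (by simp only; omega)
  | false =>
      exact Run.mono (Run.seq (run_clearProg_right _) (Run.seq (run_clearProg_ins _) (Run.seq
        (Run.iteFalse rfl (Run.seq (Run.pushOut _) (Run.pushOut _)))
        (Run.load _)))) (by simp only; omega)

/-- Treat the requested outcomes one by one. -/
noncomputable def roundsProg (T : Table arity) : Prog arity :=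
  .loop (fun v => v.found) <| (execProg T).seq <| recordProg.seq <| restoreProg.seq pickProg

/-- The whole program. -/
noncomputable def mainProg (T : Table arity) : Prog arity :=
  readProg.seq <| rewind.seq <| (Prog.push .out fun _ => some true).seq <|
    pickProg.seq <| (roundsProg T).seq writeProg

end

section

variable {G : Type} {arity : G → ℕ}

/-! ### The effect of the instructions on rows -/

/-- The `i`-th place of a gate. -/
def slotAt (g : G) (i : ℕ) : Option (Slot arity) :=
  if h : i < arity g then some ⟨g, i, h⟩ else none

theorem slotAt_of_lt (g : G) {i : ℕ} (h : i < arity g) :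
    slotAt g i = some (⟨g, i, h⟩ : Slot arity) :=
  dif_pos h

theorem slotAt_bind_nextSlot (g : G) (i : ℕ) :
    (slotAt (arity := arity) g i).bind nextSlot = slotAt g (i + 1) := by
  by_cases h : i < arity g
  · simp [slotAt, h, nextSlot]
  · have h' : ¬ i + 1 < arity g := by omega
    simp [slotAt, h, h']

/-- The instructions for the qubits of a gate, the last one to be executed first. -/
def indexInstrs (g : G) : ℕ → List ℕ → List (Instr arity)
  | _, [] => []
  | i, j :: js =>
      (slotAt g i).toList.map .mark ++ (List.replicate j (.entry .I) ++ indexInstrs g (i + 1) js)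

/-- The instructions for a gate, the last one to be executed first. -/
def stepInstrs {n : ℕ} (s : (g : G) × (Fin (arity g) ↪ Fin n)) : List (Instr arity) :=
  .gate s.1 :: indexInstrs s.1 0 (List.ofFn fun i => (s.2 i : ℕ))

theorem foldl_read_ticks (r : Reading arity) (j : ℕ) :
    (List.replicate j Sym.tick).foldl Reading.read r =
      { r with ins := List.replicate j (.entry .I) ++ r.ins } := by
  induction j generalizing r with
  | zero => rfl
  | succ j ih =>
      rw [List.replicate_succ, List.foldl_cons, ih, List.replicate_succ']
      simp [Reading.read]

/-- The mark of a place is pushed before the ticks of its index, because the stack reverses the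
order: in execution the moves come first. Therefore the starting point already contains the mark of
place `i`, and after the last index no place is left. -/
theorem foldl_read_indices (g : G) (L : List (Cell arity)) (js : List ℕ) :
    ∀ (i : ℕ) (I : List (Instr arity)), i + js.length = arity g →
      (js.flatMap fun j => List.replicate j Sym.tick ++ [Sym.endIndex]).foldl Reading.read
        ⟨slotAt g i, (slotAt g i).toList.map .mark ++ I, L⟩ =
      ⟨none, (indexInstrs g i js).reverse ++ I, L⟩ := by
  induction js with
  | nil =>
      intro i I h
      have h' : ¬ i < arity g := by simp at h; omega
      simp [slotAt, h', indexInstrs]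
  | cons j js ih =>
      intro i I h
      have h' : i < arity g := by simp at h; omega
      have := ih (i + 1) (List.replicate j (.entry .I) ++ ((slotAt g i).toList.map .mark ++ I))
        (by simp at h; omega)
      rw [List.flatMap_cons, List.foldl_append, List.foldl_append, foldl_read_ticks]
      simp only [List.foldl_cons, List.foldl_nil, Reading.read, slotAt_bind_nextSlot, this]
      simp [indexInstrs, slotAt_of_lt g h']

theorem encodeStep_eq {n : ℕ} (s : (g : G) × (Fin (arity g) ↪ Fin n)) :
    encodeStep s = Sym.gate s.1 :: (List.ofFn fun i => (s.2 i : ℕ)).flatMap fun j =>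
      List.replicate j Sym.tick ++ [Sym.endIndex] := by
  -- The coercion of the list of indices to natural numbers in `encodeStep` is a monadic bind.
  have h : (do
      let a ← List.ofFn s.2
      pure (a : ℕ)) = List.ofFn fun i => (s.2 i : ℕ) := by
    rw [List.bind_eq_flatMap]
    exact (List.flatMap_pure_eq_map _ _).trans List.map_ofFn
  rw [encodeStep, h]

theorem foldl_read_step {n : ℕ} (s : (g : G) × (Fin (arity g) ↪ Fin n)) (o : Option (Slot arity))
    (I : List (Instr arity)) (L : List (Cell arity)) :
    (encodeStep s).foldl Reading.read ⟨o, I, L⟩ = ⟨none, (stepInstrs s).reverse ++ I, L⟩ := by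
  have h := foldl_read_indices (arity := arity) s.1 L (List.ofFn fun i => (s.2 i : ℕ)) 0
    (.gate s.1 :: I) (by simp)
  rw [encodeStep_eq, List.foldl_cons]
  simp only [Reading.read]
  refine h.trans ?_
  simp [stepInstrs]

theorem foldl_read_circuit {n : ℕ} (C : Circuit arity n) (L : List (Cell arity)) :
    ∀ I : List (Instr arity), (C.flatMap encodeStep).foldl Reading.read ⟨none, I, L⟩ =
      ⟨none, (C.flatMap stepInstrs).reverse ++ I, L⟩ := by
  induction C with
  | nil => simp
  | cons s C ih =>
      intro I
      rw [List.flatMap_cons, List.foldl_append, foldl_read_step, ih]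
      simp

/-- The cells of a row. -/
def cells {n : ℕ} (w : Fin n → Pauli) (o : Fin n → Option (Fin 2)) : List (Cell arity) :=
  List.ofFn fun i => ⟨w i, .I, none, o i⟩

/-- Reading onto a stack leaves the last gate on top. This is the order that is needed, since
conjugation by the inverse circuit begins with the last gate. -/
theorem foldl_read_query (Q : Query arity) :
    (encodeQuery Q).foldl Reading.read ⟨none, [], []⟩ =
      ⟨none, (Q.circuit.flatMap stepInstrs).reverse, (cells (fun _ => .I) Q.outcome).reverse⟩ := by
  have h : ∀ (l : List (Option (Fin 2))) (L : List (Cell arity)),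
      (l.map Sym.outcome).foldl Reading.read ⟨none, [], L⟩ =
        ⟨none, [], (l.map fun b => ⟨.I, .I, none, b⟩).reverse ++ L⟩ := by
    intro l
    induction l with
    | nil => simp
    | cons b l ih =>
        intro L
        simp [Reading.read, ih]
  rw [encodeQuery, List.foldl_append, h, foldl_read_circuit, List.map_ofFn]
  simp [cells, Function.comp_def]

/-- Each tick yields one move, and each end of an index accounts for at most one mark. -/
theorem length_indexInstrs_le (g : G) (js : List ℕ) : ∀ i : ℕ,
    (indexInstrs (arity := arity) g i js).length ≤
      (js.flatMap fun j => List.replicate j (Sym.tick (G := G)) ++ [Sym.endIndex]).length := by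
  induction js with
  | nil => simp [indexInstrs]
  | cons j js ih =>
      intro i
      have h : (slotAt (arity := arity) g i).toList.length ≤ 1 := by
        cases slotAt (arity := arity) g i <;> simp
      have := ih (i + 1)
      simp only [indexInstrs, List.length_append, List.length_map, List.length_replicate,
        List.flatMap_cons, List.length_singleton] at this ⊢
      omega

theorem length_stepInstrs_le {n : ℕ} (s : (g : G) × (Fin (arity g) ↪ Fin n)) :
    (stepInstrs s).length ≤ (encodeStep s).length := by
  have h := length_indexInstrs_le (arity := arity) s.1 (List.ofFn fun i => (s.2 i : ℕ)) 0
  rw [stepInstrs, encodeStep_eq, List.length_cons, List.length_cons]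
  exact Nat.succ_le_succ h

theorem length_flatMap_stepInstrs_le {n : ℕ} (C : Circuit arity n) :
    (C.flatMap stepInstrs).length ≤ (C.flatMap encodeStep).length := by
  induction C with
  | nil => simp
  | cons s C ih =>
      have := length_stepInstrs_le s
      simp only [List.flatMap_cons, List.length_append]
      omega

/-! ### Execution of the instructions of one gate -/

/-- Execute a list of instructions. -/
noncomputable def exec (T : Table arity) (I : List (Instr arity)) (z : Zip arity) : Zip arity :=
  I.foldl (fun z i => i.act T z) z

theorem exec_append (T : Table arity) (I J : List (Instr arity)) (z : Zip arity) :
    exec T (I ++ J) z = exec T J (exec T I z) :=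
  List.foldl_append

/-- The identity flips nothing and is what an idle cell holds as its noted entry, so `.entry .I` is
a pure move. -/
theorem exec_moves (T : Table arity) (c : ZMod 4) (f : Bool) (R A : List (Cell arity)) :
    ∀ L : List (Cell arity), (∀ e ∈ A, e.q = .I) →
      exec T (List.replicate A.length (.entry .I)) ⟨c, f, L, A ++ R⟩ =
        ⟨c, f, A.reverse ++ L, R⟩ := by
  induction A with
  | nil => intros; rfl
  | cons e A ih =>
      intro L hA
      have he : { e with q := .I } = e := by
        rw [← hA e (by simp)]
      have := ih (e :: L) fun e' he' => hA e' (List.mem_cons_of_mem _ he')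
      rw [List.length_cons, List.replicate_succ, exec, List.foldl_cons]
      refine Eq.trans ?_ (this.trans (by simp))
      have : Instr.act T (.entry .I) ⟨c, f, L, e :: A ++ R⟩ = ⟨c, f, e :: L, A ++ R⟩ := by
        simp [Instr.act, Pauli.hasX, he]
      rw [this, exec]

theorem map_merge_false {A : List (Cell arity)} (hA : ∀ e ∈ A, e.q = .I) :
    A.map (Cell.merge false) = A := by
  conv_rhs => rw [← List.map_id A]
  refine List.map_congr_left fun e he => ?_
  simp [Cell.merge, ← hA e he]

theorem sum_map_twist_false (A : List (Cell arity)) : (A.map (Cell.twist false)).sum = 0 := by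
  induction A with
  | nil => rfl
  | cons e A ih => simp [ih, Cell.twist]

theorem exec_mark (T : Table arity) (c : ZMod 4) (A R : List (Cell arity)) (e : Cell arity)
    (s : Slot arity) (hA : ∀ e ∈ A, e.q = .I) :
    exec T (List.replicate A.length (.entry .I) ++ [.mark s]) ⟨c, false, [], A ++ e :: R⟩ =
      ⟨c, false, [], A ++ { e with slot := some s } :: R⟩ := by
  rw [exec_append, exec_moves T c false (e :: R) A [] hA]
  simp [exec, Instr.act, Zip.rewind, List.map_reverse, map_merge_false hA, List.sum_reverse,
    sum_map_twist_false]

theorem exec_mark_ofFn {n : ℕ} (T : Table arity) (c : ZMod 4) (f : Fin n → Cell arity) (j : Fin n)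
    (s : Slot arity) (hf : ∀ i, (f i).q = .I) :
    exec T (List.replicate j (.entry .I) ++ [.mark s]) ⟨c, false, [], List.ofFn f⟩ =
      ⟨c, false, [], List.ofFn fun x => if (x : ℕ) = j then { f x with slot := some s } else f x⟩ := by
  have hj : (j : ℕ) < (List.ofFn f).length := by simp
  have h₁ : List.ofFn f = (List.ofFn f).take j ++ f j :: (List.ofFn f).drop (j + 1) := by
    conv_lhs => rw [← List.take_append_drop j (List.ofFn f), List.drop_eq_getElem_cons hj]
    simp
  have h₂ : (List.ofFn fun x => if (x : ℕ) = j then { f x with slot := some s } else f x) =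
      (List.ofFn f).take j ++ { f j with slot := some s } :: (List.ofFn f).drop (j + 1) := by
    have : (List.ofFn fun x => if (x : ℕ) = j then { f x with slot := some s } else f x) =
        (List.ofFn f).set j { f j with slot := some s } := by
      refine List.ext_getElem (by simp) fun i hi _ => ?_
      rw [List.getElem_set]
      by_cases h : (j : ℕ) = i
      · subst h
        simp
      · simp [h, Ne.symm h]
    rw [this, List.set_eq_take_append_cons_drop]
    simp
  have h₃ : ((List.ofFn f).take j).length = j := by simp
  have := exec_mark T c ((List.ofFn f).take j) ((List.ofFn f).drop (j + 1)) (f j) s (by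
    intro e he
    obtain ⟨i, rfl⟩ := (List.mem_ofFn' _ _).1 (List.mem_of_mem_take he)
    exact hf i)
  rw [h₃] at this
  rw [h₂, ← this, ← h₁]

/-- The marks that result from the instructions for the qubits of a gate. -/
def marks (g : G) : ℕ → List ℕ → ℕ → Option (Slot arity)
  | _, [], _ => none
  | i, j :: js, x => if x = j then slotAt g i else marks g (i + 1) js x

theorem marks_of_notMem (g : G) (x : ℕ) (js : List ℕ) :
    ∀ i : ℕ, x ∉ js → marks (arity := arity) g i js x = none := by
  induction js with
  | nil => intros; rfl
  | cons j js ih =>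
      intro i h
      rw [List.mem_cons, not_or] at h
      simp [marks, h.1, ih (i + 1) h.2]

theorem marks_getElem (g : G) (js : List ℕ) : ∀ (i t : ℕ) (ht : t < js.length), js.Nodup →
    marks (arity := arity) g i js js[t] = slotAt g (i + t) := by
  induction js with
  | nil =>
      intro i t ht
      simp at ht
  | cons j js ih =>
      intro i t ht hn
      rw [List.nodup_cons] at hn
      cases t with
      | zero => simp [marks]
      | succ t =>
          have ht' : t < js.length := by simpa using ht
          have : js[t] ≠ j := fun h => hn.1 (h ▸ List.getElem_mem ht')
          simp only [List.getElem_cons_succ, marks, if_neg this, ih (i + 1) t ht' hn.2]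
          congr 1
          omega

/-- In the reversed list the marks of the later places are executed first, so the induction
hypothesis for the tail applies before the mark of place `i` is set. Each mark returns to the first
cell, from which the next index is counted. -/
theorem exec_indexInstrs {n : ℕ} (T : Table arity) (g : G) (c : ZMod 4) (w : Fin n → Pauli)
    (o : Fin n → Option (Fin 2)) (js : List ℕ) : ∀ i : ℕ, i + js.length = arity g →
      (∀ j ∈ js, j < n) →
      exec T (indexInstrs g i js).reverse ⟨c, false, [], cells w o⟩ =
        ⟨c, false, [], List.ofFn fun x => ⟨w x, .I, marks g i js x, o x⟩⟩ := by
  induction js with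
  | nil => intros; rfl
  | cons j js ih =>
      intro i hi hj
      have hi' : i < arity g := by simp at hi; omega
      have h := ih (i + 1) (by simp at hi; omega) fun j hj' => hj j (List.mem_cons_of_mem _ hj')
      simp only [indexInstrs, slotAt_of_lt g hi', List.reverse_append, List.append_assoc,
        exec_append, h]
      have := exec_mark_ofFn T c (fun x : Fin n =>
        (⟨w x, .I, marks g (i + 1) js x, o x⟩ : Cell arity)) ⟨j, hj j (by simp)⟩ ⟨g, i, hi'⟩
        fun _ => rfl
      rw [exec_append] at this
      simp only [List.reverse_replicate]
      refine this.trans ?_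
      simp only [marks, slotAt_of_lt g hi']
      congr 2
      funext x
      split_ifs <;> rfl

/-- A later cell with the same mark overwrites an earlier one, so all cells marked `s` are required
to agree. -/
theorem foldl_collect {s : Slot arity} {p : Pauli} (R : List (Cell arity)) :
    ∀ f : Slot arity → Pauli, (f s = p ∨ ∃ e ∈ R, e.slot = some s) →
      (∀ e ∈ R, e.slot = some s → e.p = p) → R.foldl Cell.collect f s = p := by
  classical
  induction R with
  | nil =>
      intro f h _
      simpa using h
  | cons e R ih =>
      intro f h hp
      rw [List.foldl_cons]
      refine ih _ ?_ fun e' he' => hp e' (List.mem_cons_of_mem _ he')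
      by_cases he : e.slot = some s
      · left
        simp [Cell.collect, he, hp e (by simp) he]
      · rcases h with h | ⟨e', he', hs⟩
        · left
          rw [← h, Cell.collect]
          cases hs : e.slot with
          | none => rfl
          | some s' => exact Function.update_of_ne (fun h => he (by rw [hs, h])) _ _
        · rcases List.mem_cons.1 he' with rfl | he'
          · exact absurd hs he
          · exact Or.inr ⟨e', he', hs⟩

/-- The effect of a gate on a row. -/
theorem exec_stepInstrs {n : ℕ} (T : Table arity) (s : (g : G) × (Fin (arity g) ↪ Fin n))
    (c : ZMod 4) (w : Fin n → Pauli) (o : Fin n → Option (Fin 2)) :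
    ∃ (f : Slot arity → Pauli) (w' : Fin n → Pauli), (∀ t, f ⟨s.1, t⟩ = w (s.2 t)) ∧
      (∀ t, w' (s.2 t) = (T s.1 f).2 ⟨s.1, t⟩) ∧ (∀ x, x ∉ Set.range s.2 → w' x = w x) ∧
      exec T (stepInstrs s).reverse ⟨c, false, [], cells w o⟩ =
        ⟨c + (T s.1 f).1, false, [], cells w' o⟩ := by
  obtain ⟨g, q⟩ := s
  let m : Fin n → Option (Slot arity) := fun x => marks g 0 (List.ofFn fun i => (q i : ℕ)) x
  have hm : ∀ t, m (q t) = some ⟨g, t⟩ := by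
    intro t
    have h := marks_getElem (arity := arity) g (List.ofFn fun i => (q i : ℕ)) 0 t (by simp)
      (List.nodup_ofFn.2 (Fin.val_injective.comp q.injective))
    simpa [slotAt, m] using h
  have hm' : ∀ x, x ∉ Set.range q → m x = none := by
    intro x hx
    refine marks_of_notMem g _ _ _ fun h => hx ?_
    obtain ⟨t, ht⟩ := (List.mem_ofFn' _ _).1 h
    exact ⟨t, Fin.ext ht⟩
  let R : List (Cell arity) := List.ofFn fun x => ⟨w x, .I, m x, o x⟩
  let f : Slot arity → Pauli := R.foldl Cell.collect fun _ => .I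
  refine ⟨f, fun x => match m x with | some s => (T g f).2 s | none => w x, ?_, ?_, ?_, ?_⟩
  · intro t
    refine foldl_collect R _ (Or.inr ⟨⟨w (q t), .I, m (q t), o (q t)⟩, ?_, hm t⟩) ?_
    · exact (List.mem_ofFn' _ _).2 ⟨q t, rfl⟩
    · intro e he hs
      obtain ⟨x, rfl⟩ := (List.mem_ofFn' _ _).1 he
      by_cases hx : x ∈ Set.range q
      · obtain ⟨t', rfl⟩ := hx
        have : t' = t := by simpa [hm] using hs
        rw [this]
      · simp [hm' x hx] at hs
  · intro t
    simp [hm]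
  · intro x hx
    simp [hm' x hx]
  · rw [stepInstrs, List.reverse_cons, exec_append, exec_indexInstrs T g c w o _ 0 (by simp) (by
      intro j hj
      obtain ⟨t, rfl⟩ := (List.mem_ofFn' _ _).1 hj
      exact (q t).2)]
    simp only [exec, List.foldl_cons, List.foldl_nil, Instr.act, List.append_nil]
    rw [List.map_reverse, List.reverse_reverse, List.map_ofFn]
    congr 1
    refine congrArg List.ofFn (funext fun x => ?_)
    change Cell.replace (T g f).2 ⟨w x, .I, m x, o x⟩ = _
    cases h : m x <;> simp [Cell.replace, h]

/-! ### Reduction by a recorded row -/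

/-- Whether the entry of the row `ws` at the last position at which `bs` flips the bit does so, too;
`f` if there is no such position. -/
def flipsAtPivot (f : Bool) : List Pauli → List Pauli → Bool
  | b :: bs, w :: ws => flipsAtPivot (bif b.hasX then w.hasX else f) bs ws
  | _, _ => f

/-- Every flipping position of `bs` overwrites the flag, so the last one decides. A position found
in the tail therefore prevails over the head, and the initial value survives only if there is none.
-/
theorem flipsAtPivot_spec (bs : List Pauli) :
    ((∀ b ∈ bs, b.hasX = false) ∧ ∀ (f : Bool) (ws : List Pauli), flipsAtPivot f bs ws = f) ∨
      ∃ (i : ℕ) (hi : i < bs.length), bs[i].hasX = true ∧ ∀ (f : Bool) (ws : List Pauli)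
        (hw : ws.length = bs.length), flipsAtPivot f bs ws = ws[i].hasX := by
  induction bs with
  | nil => exact Or.inl ⟨by simp, fun f ws => rfl⟩
  | cons b bs ih =>
      rcases ih with ⟨h₁, h₂⟩ | ⟨i, hi, h₁, h₂⟩
      · cases hb : b.hasX with
        | false =>
            refine Or.inl ⟨by simpa [hb] using h₁, fun f ws => ?_⟩
            cases ws <;> simp [flipsAtPivot, hb, h₂]
        | true =>
            refine Or.inr ⟨0, by simp, hb, fun f ws hw => ?_⟩
            cases ws with
            | nil => simp at hw
            | cons w ws => simp [flipsAtPivot, hb, h₂]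
      · refine Or.inr ⟨i + 1, by simpa using hi, by simpa using h₁, fun f ws hw => ?_⟩
        cases ws with
        | nil => simp at hw
        | cons w ws =>
            simp only [flipsAtPivot, List.getElem_cons_succ]
            exact h₂ _ ws (by simpa using hw)

theorem exec_entries (T : Table arity) (c : ZMod 4) (bs : List Pauli) :
    ∀ (f : Bool) (L R : List (Cell arity)), R.length = bs.length →
      exec T (bs.map .entry) ⟨c, f, L, R⟩ =
        ⟨c, flipsAtPivot f bs (R.map Cell.p),
          (List.zipWith (fun (e : Cell arity) b => { e with q := b }) R bs).reverse ++ L, []⟩ := by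
  induction bs with
  | nil =>
      intro f L R hR
      rw [List.length_nil, List.length_eq_zero_iff] at hR
      subst hR
      simp [exec, flipsAtPivot]
  | cons b bs ih =>
      intro f L R hR
      cases R with
      | nil => simp at hR
      | cons e R =>
          have h := ih (bif b.hasX then e.p.hasX else f) ({ e with q := b } :: L) R (by simpa using hR)
          rw [List.map_cons, exec, List.foldl_cons]
          refine h.trans ?_
          simp [flipsAtPivot]

/-- The instructions for the reduction by a row. -/
def rowInstrs {n : ℕ} (b : ZMod 4 × (Fin n → Pauli)) : List (Instr arity) :=
  (List.ofFn b.2).map .entry ++ [.finish b.1]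

/-- Whether a row is multiplied by `b` in the reduction. -/
def isReducible {n : ℕ} (b w : Fin n → Pauli) : Bool :=
  flipsAtPivot false (List.ofFn b) (List.ofFn w)

/-- The reduction of a row by another one. -/
def reduceBy {n : ℕ} (r b : ZMod 4 × (Fin n → Pauli)) : ZMod 4 × (Fin n → Pauli) :=
  bif isReducible b.2 r.2 then
    (r.1 + b.1 + ∑ i, (r.2 i).phase (b.2 i), fun i => (r.2 i).mul (b.2 i))
  else r

/-- The entries are only noted while the row is traversed, since the pivot is known at its end. The
product is formed on the way back, if the flag is then set. -/
theorem exec_rowInstrs {n : ℕ} (T : Table arity) (r b : ZMod 4 × (Fin n → Pauli))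
    (o : Fin n → Option (Fin 2)) :
    exec T (rowInstrs b) ⟨r.1, false, [], cells r.2 o⟩ =
      ⟨(reduceBy r b).1, false, [], cells (reduceBy r b).2 o⟩ := by
  have h₁ : (cells (arity := arity) r.2 o).map Cell.p = List.ofFn r.2 := by
    rw [cells, List.map_ofFn]
    rfl
  have h₂ : List.zipWith (fun (e : Cell arity) b => { e with q := b }) (cells r.2 o)
      (List.ofFn b.2) = List.ofFn fun i => ⟨r.2 i, b.2 i, none, o i⟩ := by
    refine List.ext_getElem (by simp [cells]) fun i _ _ => ?_
    simp [cells]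
  rw [rowInstrs, exec_append, exec_entries T _ _ _ _ _ (by simp [cells]), h₁, h₂, ← isReducible]
  simp only [exec, List.foldl_cons, List.foldl_nil, Instr.act, Zip.rewind, List.append_nil,
    List.map_reverse, List.reverse_reverse, List.sum_reverse, List.map_ofFn, Function.comp_def,
    reduceBy, List.sum_ofFn]
  cases isReducible b.2 r.2 <;> simp [Cell.merge, Cell.twist, cells]

theorem exec_flatMap_rowInstrs {n : ℕ} (T : Table arity) (o : Fin n → Option (Fin 2))
    (bs : List (ZMod 4 × (Fin n → Pauli))) : ∀ r : ZMod 4 × (Fin n → Pauli),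
    exec T (bs.flatMap rowInstrs) ⟨r.1, false, [], cells r.2 o⟩ =
      ⟨(bs.foldl reduceBy r).1, false, [], cells (bs.foldl reduceBy r).2 o⟩ := by
  induction bs with
  | nil => intros; rfl
  | cons b bs ih =>
      intro r
      rw [List.flatMap_cons, exec_append, exec_rowInstrs, ih, List.foldl_cons]

/-- Correctness only needs some requested qubit; that the first one is taken plays no role. -/
theorem pick_cells {n : ℕ} (w : Fin n → Pauli) (o : Fin n → Option (Fin 2)) :
    ((∀ i, o i = none) ∧ pick (cells (arity := arity) w o) = (none, cells (fun _ => .I) o)) ∨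
      ∃ i b, o i = some b ∧ pick (cells (arity := arity) w o) =
        (some b, cells (Function.update (fun _ => .I) i .Z) (Function.update o i none)) := by
  induction n with
  | zero => exact Or.inl ⟨fun i => i.elim0, rfl⟩
  | succ n ih =>
      have hc : cells (arity := arity) w o =
          ⟨w 0, .I, none, o 0⟩ :: cells (fun i => w i.succ) fun i => o i.succ := by
        simp [cells, List.ofFn_succ]
      rw [hc, pick]
      cases h₀ : o 0 with
      | some b =>
          refine Or.inr ⟨0, b, h₀, ?_⟩
          simp [cells, List.ofFn_succ, List.map_ofFn, Function.comp_def, Cell.reset]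
      | none =>
          rcases ih (fun i => w i.succ) (fun i => o i.succ) with ⟨h₁, h₂⟩ | ⟨i, b, h₁, h₂⟩
          · refine Or.inl ⟨fun i => Fin.cases h₀ h₁ i, ?_⟩
            simp only [h₂]
            simp [cells, List.ofFn_succ, Cell.reset, h₀]
          · refine Or.inr ⟨i.succ, b, h₁, ?_⟩
            simp only [h₂]
            simp only [cells, List.ofFn_succ, Cell.reset]
            rw [Function.update_of_ne (Fin.succ_ne_zero i).symm,
              Function.update_of_ne (Fin.succ_ne_zero i).symm, h₀]
            congr 3
            funext j
            by_cases hj : j = i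
            · subst hj
              simp
            · rw [Function.update_of_ne hj, Function.update_of_ne hj,
                Function.update_of_ne (fun h => hj (Fin.succ_injective _ h)),
                Function.update_of_ne (fun h => hj (Fin.succ_injective _ h))]

end

section

/-! ### Products of Pauli matrices -/

/-- The phase `i ^ c`. -/
noncomputable def iPow (c : ZMod 4) : ℂ := Complex.I ^ c.val

theorem iPow_add (a b : ZMod 4) : iPow (a + b) = iPow a * iPow b := by
  rw [iPow, iPow, iPow, ← pow_add, ZMod.val_add, ← Complex.I_pow_eq_pow_mod]

theorem iPow_zero : iPow 0 = 1 := by simp [iPow]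

theorem iPow_one : iPow 1 = Complex.I := by
  rw [iPow, show (1 : ZMod 4).val = 1 from rfl, pow_one]

theorem iPow_two : iPow 2 = -1 := by
  rw [iPow, show (2 : ZMod 4).val = 2 from rfl, Complex.I_sq]

theorem iPow_three : iPow 3 = -Complex.I := by
  rw [iPow, show (3 : ZMod 4).val = 3 from rfl, Complex.I_pow_three]

theorem iPow_sum {ι : Type} (s : Finset ι) (f : ι → ZMod 4) :
    iPow (∑ i ∈ s, f i) = ∏ i ∈ s, iPow (f i) := by
  classical
  induction s using Finset.induction_on with
  | empty => simp [iPow_zero]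
  | insert a s ha ih => rw [Finset.sum_insert ha, Finset.prod_insert ha, iPow_add, ih]

theorem exists_iPow_iff (x : ℂ) :
    (∃ c, x = iPow c) ↔ x = 1 ∨ x = -1 ∨ x = Complex.I ∨ x = -Complex.I := by
  constructor
  · rintro ⟨c, rfl⟩
    have hc : c = 0 ∨ c = 1 ∨ c = 2 ∨ c = 3 := by
      revert c
      decide
    rcases hc with rfl | rfl | rfl | rfl
    · exact Or.inl iPow_zero
    · exact Or.inr (Or.inr (Or.inl iPow_one))
    · exact Or.inr (Or.inl iPow_two)
    · exact Or.inr (Or.inr (Or.inr iPow_three))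
  · rintro (rfl | rfl | rfl | rfl)
    exacts [⟨0, iPow_zero.symm⟩, ⟨2, iPow_two.symm⟩, ⟨1, iPow_one.symm⟩, ⟨3, iPow_three.symm⟩]

theorem iPow_eq_neg_one {c : ZMod 4} (hc : c ≠ 0) (h : iPow c * iPow c = 1) : iPow c = -1 := by
  have : c = 0 ∨ c = 1 ∨ c = 2 ∨ c = 3 := by
    clear hc h
    revert c
    decide
  rcases this with rfl | rfl | rfl | rfl
  · exact absurd rfl hc
  · rw [iPow_one, Complex.I_mul_I] at h
    norm_num at h
  · exact iPow_two
  · rw [iPow_three, neg_mul_neg, Complex.I_mul_I] at h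
    norm_num at h

theorem Pauli.toMatrix_mul (p q : Pauli) :
    p.toMatrix * q.toMatrix = iPow (p.phase q) • (p.mul q).toMatrix := by
  cases p <;> cases q <;> ext i j <;> fin_cases i <;> fin_cases j <;>
    simp [Pauli.toMatrix, Pauli.mul, Pauli.phase, iPow_zero, iPow_one, iPow_three, Matrix.mul_apply]

theorem Pauli.hasX_mul (p q : Pauli) : (p.mul q).hasX = (p.hasX ^^ q.hasX) := by
  cases p <;> cases q <;> rfl

theorem Pauli.toMatrix_ne_zero {p : Pauli} {a b : Fin 2} (h : p.toMatrix a b ≠ 0) :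
    a = b ↔ p.hasX = false := by
  cases p <;> fin_cases a <;> fin_cases b <;> simp_all [Pauli.toMatrix, Pauli.hasX]

theorem Pauli.toMatrix_zero_right {p : Pauli} (hp : p.hasX = false) (a : Fin 2) :
    p.toMatrix a 0 = if a = 0 then 1 else 0 := by
  cases p <;> fin_cases a <;> simp_all [Pauli.toMatrix, Pauli.hasX]

variable {n : ℕ}

theorem pauliTensor_mul (w b : Fin n → Pauli) :
    pauliTensor w * pauliTensor b =
      iPow (∑ i, (w i).phase (b i)) • pauliTensor fun i => (w i).mul (b i) := by
  ext x z
  rw [iPow_sum, Matrix.mul_apply, Matrix.smul_apply]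
  simp only [pauliTensor, Matrix.of_apply, smul_eq_mul, ← Finset.prod_mul_distrib]
  -- By distributivity the sum over intermediate bit strings is a product of sums over single bits.
  rw [← Fintype.piFinset_univ, ← Finset.prod_univ_sum (fun _ => Finset.univ)
    fun i y => (w i).toMatrix (x i) y * (b i).toMatrix y (z i)]
  refine Finset.prod_congr rfl fun i _ => ?_
  rw [← Matrix.mul_apply, Pauli.toMatrix_mul, Matrix.smul_apply, smul_eq_mul]

/-- A Pauli product is a monomial matrix: it sends a basis vector to a multiple of the one obtained
by flipping the bits at its entries X and Y. -/
theorem pauliTensor_ne_zero {w : Fin n → Pauli} {x y : Bits n} (h : pauliTensor w x y ≠ 0)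
    (i : Fin n) : x i = y i ↔ (w i).hasX = false :=
  Pauli.toMatrix_ne_zero (Finset.prod_ne_zero_iff.1
    (show ∏ i, (w i).toMatrix (x i) (y i) ≠ 0 from h) i (Finset.mem_univ i))

theorem pauliTensor_mulVec_zeroState {w : Fin n → Pauli} (hw : ∀ i, (w i).hasX = false) :
    (pauliTensor w).mulVec (zeroState n) = zeroState n := by
  rw [zeroState, Matrix.mulVec_single_one]
  ext x
  simp only [Matrix.col_apply, pauliTensor, Matrix.of_apply, Pauli.toMatrix_zero_right (hw _),
    Pi.single_apply]
  rw [Finset.prod_ite_zero]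
  simp [funext_iff]

/-- The operator of a row. -/
noncomputable def rowOp (r : ZMod 4 × (Fin n → Pauli)) : Op n := iPow r.1 • pauliTensor r.2

theorem rowOp_mul (r b : ZMod 4 × (Fin n → Pauli)) :
    rowOp r * rowOp b =
      rowOp (r.1 + b.1 + ∑ i, (r.2 i).phase (b.2 i), fun i => (r.2 i).mul (b.2 i)) := by
  simp only [rowOp, Matrix.smul_mul, Matrix.mul_smul, pauliTensor_mul, iPow_add, smul_smul]
  ring_nf

theorem mem_pauliGroup {M : Op n} : M ∈ pauliGroup n ↔ ∃ r, M = rowOp r := by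
  constructor
  · rintro ⟨c, hc, P, rfl⟩
    obtain ⟨c, rfl⟩ := (exists_iPow_iff _).2 hc
    exact ⟨(c, P), rfl⟩
  · rintro ⟨r, rfl⟩
    exact ⟨iPow r.1, (exists_iPow_iff _).1 ⟨_, rfl⟩, r.2, rfl⟩

theorem finite_pauliGroup : (pauliGroup n).Finite := by
  have : Finite (ZMod 4) := inferInstanceAs (Finite (Fin 4))
  refine (Set.finite_range (rowOp (n := n))).subset fun M hM => ?_
  obtain ⟨r, rfl⟩ := mem_pauliGroup.1 hM
  exact ⟨r, rfl⟩

/-- The inverse of a Clifford operation transforms Pauli products into Pauli products, too. -/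
theorem IsClifford.conjTranspose_mul_mul {U : Op n} (hU : IsClifford U) {M : Op n}
    (hM : M ∈ pauliGroup n) : U.conjTranspose * M * U ∈ pauliGroup n := by
  have h₁ : U.conjTranspose * U = 1 := Matrix.mem_unitaryGroup_iff'.1 hU.1
  have hinv : ∀ N : Op n, U.conjTranspose * (U * N * U.conjTranspose) * U = N := by
    intro N
    calc U.conjTranspose * (U * N * U.conjTranspose) * U =
        (U.conjTranspose * U) * N * (U.conjTranspose * U) := by simp only [Matrix.mul_assoc]
      _ = N := by rw [h₁, Matrix.one_mul, Matrix.mul_one]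
  have := finite_pauliGroup (n := n).to_subtype
  let f : pauliGroup n → pauliGroup n := fun N => ⟨U * N * U.conjTranspose, hU.2 N N.2⟩
  have hf : Function.Injective f := by
    intro N N' h
    have := congrArg (fun K : pauliGroup n => U.conjTranspose * K.1 * U) h
    simp only [f, hinv] at this
    exact Subtype.ext this
  obtain ⟨N, hN⟩ := Finite.surjective_of_injective hf ⟨M, hM⟩
  have hN' : U * N * U.conjTranspose = M := congrArg Subtype.val hN
  rw [← hN', hinv]
  exact N.2

/-! ### Operators on some of the qubits -/

section ApplyOn

variable {k : ℕ} (q : Fin k ↪ Fin n)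

/-- A bit string, split into the bits at the positions `q` and the other ones. -/
noncomputable def splitBits : Bits n ≃ Bits k × ({j // j ∉ Set.range q} → Fin 2) :=
  open Classical in
  (Equiv.piEquivPiSubtypeProd (· ∈ Set.range q) fun _ => Fin 2).trans <|
    Equiv.prodCongr ((Equiv.ofInjective q q.injective).symm.arrowCongr (Equiv.refl _))
      (Equiv.refl _)

theorem splitBits_apply (x : Bits n) : splitBits q x = (fun i => x (q i), fun j => x j.1) := rfl

open scoped Kronecker

/-- Splitting off the bits at `q` turns the action on some qubits into a Kronecker product with the
identity. With `pauliTensor_eq`, unitarity and conjugation become statements about the first factor.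
-/
theorem applyOn_eq (U : Op k) : applyOn U q =
    (U ⊗ₖ (1 : Matrix ({j // j ∉ Set.range q} → Fin 2) _ ℂ)).submatrix
      (splitBits q) (splitBits q) := by
  ext x y
  simp only [applyOn, Matrix.of_apply, Matrix.submatrix_apply,
    Matrix.kroneckerMap_apply, splitBits_apply, Matrix.one_apply, funext_iff, Subtype.forall,
    mul_ite, mul_one, mul_zero]

theorem pauliTensor_eq (w : Fin n → Pauli) : pauliTensor w =
    ((pauliTensor fun i => w (q i)) ⊗ₖ (Matrix.of
      fun x y : {j // j ∉ Set.range q} → Fin 2 => ∏ j, (w j.1).toMatrix (x j) (y j))).submatrix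
      (splitBits q) (splitBits q) := by
  classical
  ext x y
  simp only [pauliTensor, Matrix.of_apply, Matrix.submatrix_apply,
    Matrix.kroneckerMap_apply, splitBits_apply]
  rw [← Fintype.prod_subtype_mul_prod_subtype (· ∈ Set.range q)]
  congr 1
  convert (Equiv.prod_comp (Equiv.ofInjective q q.injective)
    fun j => (w j).toMatrix (x j) (y j)).symm <;> rfl

theorem applyOn_mem_unitaryGroup {U : Op k} (hU : U ∈ Matrix.unitaryGroup (Bits k) ℂ) :
    applyOn U q ∈ Matrix.unitaryGroup (Bits n) ℂ := by
  rw [Matrix.mem_unitaryGroup_iff'] at hU ⊢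
  rw [Matrix.star_eq_conjTranspose] at hU ⊢
  rw [applyOn_eq, Matrix.conjTranspose_submatrix, Matrix.submatrix_mul_equiv,
    Matrix.conjTranspose_kronecker, ← Matrix.mul_kronecker_mul, hU]
  simp

theorem applyOn_conj {U : Op k} {w w' : Fin n → Pauli} {c : ℂ}
    (h : U.conjTranspose * (pauliTensor fun i => w (q i)) * U = c • pauliTensor fun i => w' (q i))
    (hw : ∀ x, x ∉ Set.range q → w' x = w x) :
    (applyOn U q).conjTranspose * pauliTensor w * applyOn U q = c • pauliTensor w' := by
  rw [applyOn_eq, pauliTensor_eq q w, pauliTensor_eq q w', Matrix.conjTranspose_submatrix,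
    Matrix.submatrix_mul_equiv, Matrix.submatrix_mul_equiv, Matrix.conjTranspose_kronecker, ← Matrix.mul_kronecker_mul,
    ← Matrix.mul_kronecker_mul, h, Matrix.smul_kronecker]
  simp only [Matrix.conjTranspose_one, Matrix.one_mul, Matrix.mul_one]
  have : ∀ j : {j // j ∉ Set.range q}, w' j.1 = w j.1 := fun j => hw j j.2
  simp only [this]
  rfl

end ApplyOn

end

section

variable {G : Type} {arity : G → ℕ} {n : ℕ}

/-! ### The circuit -/

/-- The operator of a circuit. -/
noncomputable def circuitOp (gate : (g : G) → Op (arity g)) (C : Circuit arity n) : Op n :=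
  C.foldl (fun M s => applyOn (gate s.1) s.2 * M) 1

theorem circuitOp_append_singleton (gate : (g : G) → Op (arity g)) (C : Circuit arity n)
    (s : (g : G) × (Fin (arity g) ↪ Fin n)) :
    circuitOp gate (C ++ [s]) = applyOn (gate s.1) s.2 * circuitOp gate C := by
  simp [circuitOp]

theorem outputState_eq (gate : (g : G) → Op (arity g)) (C : Circuit arity n) :
    outputState gate C = (circuitOp gate C).mulVec (zeroState n) := by
  induction C using List.reverseRecOn with
  | nil => simp [outputState, circuitOp]
  | append_singleton C s ih =>
      rw [circuitOp_append_singleton, ← Matrix.mulVec_mulVec, ← ih]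
      simp [outputState]

theorem circuitOp_mem_unitaryGroup {gate : (g : G) → Op (arity g)}
    (hgate : ∀ g, IsClifford (gate g)) (C : Circuit arity n) :
    circuitOp gate C ∈ Matrix.unitaryGroup (Bits n) ℂ := by
  induction C using List.reverseRecOn with
  | nil => exact one_mem _
  | append_singleton C s ih =>
      rw [circuitOp_append_singleton]
      exact mul_mem (applyOn_mem_unitaryGroup s.2 (hgate s.1).1) ih

/-- The table describes the conjugation by the inverses of the gates. -/
def Table.Describes (T : Table arity) (gate : (g : G) → Op (arity g)) : Prop :=
  ∀ (g : G) (f : Slot arity → Pauli),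
    (gate g).conjTranspose * (pauliTensor fun t => f ⟨g, t⟩) * gate g =
      iPow (T g f).1 • pauliTensor fun t => (T g f).2 ⟨g, t⟩

theorem exists_table {gate : (g : G) → Op (arity g)} (hgate : ∀ g, IsClifford (gate g)) :
    ∃ T : Table arity, T.Describes gate := by
  classical
  have h : ∀ (g : G) (f : Slot arity → Pauli), ∃ t : ZMod 4 × (Slot arity → Pauli),
      (gate g).conjTranspose * (pauliTensor fun t => f ⟨g, t⟩) * gate g =
        iPow t.1 • pauliTensor fun i => t.2 ⟨g, i⟩ := by
    intro g f
    obtain ⟨r, hr⟩ := mem_pauliGroup.1 ((hgate g).conjTranspose_mul_mul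
      (mem_pauliGroup.2 ⟨(0, fun t => f ⟨g, t⟩), rfl⟩))
    -- The table is indexed by the places of all gates. At the places of the other gates, `.I` is a
    -- filler that the claim does not involve.
    refine ⟨(r.1, fun s => if h : s.1 = g then r.2 (h ▸ s.2) else .I), ?_⟩
    simp only [rowOp, iPow_zero, one_smul] at hr
    simpa using hr
  choose T hT using h
  exact ⟨T, hT⟩

/-- The conjugation by a circuit with last gate V and remaining part W is r ↦ W†(V†rV)W, so the
induction removes gates from the end of the circuit, and the machine executes them in this order. -/
theorem exec_circuit {T : Table arity} {gate : (g : G) → Op (arity g)} (hT : T.Describes gate)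
    (o : Fin n → Option (Fin 2)) (C : Circuit arity n) : ∀ r : ZMod 4 × (Fin n → Pauli),
    ∃ r' : ZMod 4 × (Fin n → Pauli),
      rowOp r' = (circuitOp gate C).conjTranspose * rowOp r * circuitOp gate C ∧
      exec T (C.flatMap stepInstrs).reverse ⟨r.1, false, [], cells r.2 o⟩ =
        ⟨r'.1, false, [], cells r'.2 o⟩ := by
  induction C using List.reverseRecOn with
  | nil => exact fun r => ⟨r, by simp [circuitOp], rfl⟩
  | append_singleton C s ih =>
      intro r
      obtain ⟨f, w', hf, hw₁, hw₂, he⟩ := exec_stepInstrs T s r.1 r.2 o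
      obtain ⟨r', hr', he'⟩ := ih (r.1 + (T s.1 f).1, w')
      refine ⟨r', ?_, ?_⟩
      · have h := hT s.1 f
        simp only [hf, ← hw₁] at h
        have h' := applyOn_conj s.2 h hw₂
        rw [hr', circuitOp_append_singleton, Matrix.conjTranspose_mul]
        have : rowOp (r.1 + (T s.1 f).1, w') =
            (applyOn (gate s.1) s.2).conjTranspose * rowOp r * applyOn (gate s.1) s.2 := by
          rw [rowOp, rowOp, Matrix.mul_smul, Matrix.smul_mul, h', smul_smul, iPow_add]
        rw [this]
        simp only [Matrix.mul_assoc]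
      · rw [List.flatMap_append, List.reverse_append, exec_append]
        simp only [List.flatMap_cons, List.flatMap_nil, List.append_nil, he]
        exact he'

/-! ### The reduction of rows -/

/-- The position at which the row `b` reduces other rows. -/
def IsPivot (b : Fin n → Pauli) (p : Fin n) : Prop :=
  (b p).hasX = true ∧ ∀ w, isReducible b w = (w p).hasX

theorem exists_isPivot (b : Fin n → Pauli) :
    (∀ i, (b i).hasX = false) ∨ ∃ p, IsPivot b p := by
  rcases flipsAtPivot_spec (List.ofFn b) with ⟨h, -⟩ | ⟨i, hi, h₁, h₂⟩
  · exact Or.inl fun i => h _ ((List.mem_ofFn' _ _).2 ⟨i, rfl⟩)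
  · refine Or.inr ⟨⟨i, by simpa using hi⟩, by simpa using h₁, fun w => ?_⟩
    rw [isReducible, h₂ false (List.ofFn w) (by simp)]
    simp

theorem hasX_reduceBy (r b : ZMod 4 × (Fin n → Pauli)) {p : Fin n} (hr : (r.2 p).hasX = false)
    (hb : (b.2 p).hasX = false) : ((reduceBy r b).2 p).hasX = false := by
  rw [reduceBy]
  cases isReducible b.2 r.2
  · exact hr
  · simp [Pauli.hasX_mul, hr, hb]

/-- The row is multiplied exactly if it flips the pivot, and the product of two entries that both
flip does not flip. -/
theorem hasX_reduceBy_pivot (r b : ZMod 4 × (Fin n → Pauli)) {p : Fin n} (hp : IsPivot b.2 p) :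
    ((reduceBy r b).2 p).hasX = false := by
  rw [reduceBy]
  cases h : isReducible b.2 r.2
  · rw [hp.2] at h
    exact h
  · rw [hp.2] at h
    simp [Pauli.hasX_mul, h, hp.1]

theorem hasX_foldl_reduceBy {p : Fin n} (bs : List (ZMod 4 × (Fin n → Pauli))) :
    ∀ r : ZMod 4 × (Fin n → Pauli), (r.2 p).hasX = false → (∀ b ∈ bs, (b.2 p).hasX = false) →
      ((bs.foldl reduceBy r).2 p).hasX = false := by
  induction bs with
  | nil => exact fun r hr _ => hr
  | cons b bs ih =>
      intro r hr hb
      exact ih _ (hasX_reduceBy r b hr (hb b (by simp))) fun b' hb' => hb b' (by simp [hb'])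

/-- The recorded rows are triangular: rows after `b` do not flip the pivot of `b`, so once it has
been cleared it stays clear. -/
theorem hasX_foldl_reduceBy_pivot (bs : List (ZMod 4 × (Fin n → Pauli)))
    (hbs : bs.Pairwise fun b b' => ∀ p, IsPivot b.2 p → (b'.2 p).hasX = false) :
    ∀ (r : ZMod 4 × (Fin n → Pauli)) (b : ZMod 4 × (Fin n → Pauli)) (p : Fin n), b ∈ bs →
      IsPivot b.2 p → ((bs.foldl reduceBy r).2 p).hasX = false := by
  induction bs with
  | nil =>
      intro r b p hb
      simp at hb
  | cons a bs ih =>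
      intro r b p hb hp
      rw [List.pairwise_cons] at hbs
      rcases List.mem_cons.1 hb with rfl | hb
      · exact hasX_foldl_reduceBy bs _ (hasX_reduceBy_pivot r b hp) fun b' hb' => hbs.1 b' hb' p hp
      · exact ih hbs.2 _ b p hb hp

/-- The operator of the row is transformed by `U` into a diagonal operator with eigenvalues `±1`. -/
def IsDiag (U : Op n) (r : ZMod 4 × (Fin n → Pauli)) (D : Bits n → ℂ) : Prop :=
  (∀ x, D x * D x = 1) ∧ U * rowOp r * U.conjTranspose = Matrix.diagonal D

theorem IsDiag.mul {U : Op n} (hU : U ∈ Matrix.unitaryGroup (Bits n) ℂ)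
    {r b s : ZMod 4 × (Fin n → Pauli)} {D E : Bits n → ℂ} (hr : IsDiag U r D) (hb : IsDiag U b E)
    (hs : rowOp s = rowOp r * rowOp b) : IsDiag U s fun x => D x * E x := by
  refine ⟨fun x => by rw [mul_mul_mul_comm, hr.1, hb.1, one_mul], ?_⟩
  have h₁ : U.conjTranspose * U = 1 := Matrix.mem_unitaryGroup_iff'.1 hU
  rw [← Matrix.diagonal_mul_diagonal, ← hr.2, ← hb.2, hs]
  calc U * (rowOp r * rowOp b) * U.conjTranspose =
      U * rowOp r * 1 * (rowOp b * U.conjTranspose) := by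
        rw [Matrix.mul_one]
        simp only [Matrix.mul_assoc]
    _ = _ := by
        rw [← h₁]
        simp only [Matrix.mul_assoc]

/-- Before the circuit the row acts as multiplication by `D` does after it. In particular all such
rows commute on these vectors. -/
theorem IsDiag.mulVec {U : Op n} (hU : U ∈ Matrix.unitaryGroup (Bits n) ℂ)
    {r : ZMod 4 × (Fin n → Pauli)} {D : Bits n → ℂ} (hr : IsDiag U r D) (f : Bits n → ℂ) :
    (rowOp r).mulVec (U.conjTranspose.mulVec f) = U.conjTranspose.mulVec fun x => D x * f x := by
  have h₁ : U.conjTranspose * U = 1 := Matrix.mem_unitaryGroup_iff'.1 hU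
  have h₂ : (fun x => D x * f x) = (Matrix.diagonal D).mulVec f := by
    funext x
    rw [Matrix.mulVec_diagonal]
  rw [h₂, ← hr.2, Matrix.mulVec_mulVec, Matrix.mulVec_mulVec]
  congr 1
  calc rowOp r * U.conjTranspose = 1 * (rowOp r * U.conjTranspose) := (Matrix.one_mul _).symm
    _ = _ := by
        rw [← h₁]
        simp only [Matrix.mul_assoc]

/-- The state after the circuit, restricted by the factor `d`, and taken back to the beginning of
the circuit. -/
noncomputable def pulledBack (U : Op n) (d : Bits n → ℂ) : Bits n → ℂ :=
  U.conjTranspose.mulVec fun x => d x * U.mulVec (zeroState n) x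

/-- The invariant of the algorithm: `d` selects the outcomes that have been taken into account, `bs`
is the list of the recorded rows and `k` the number of those of them that flip bits; `fail` is set
if the outcomes are impossible. -/
def Invariant (U : Op n) (d : Bits n → ℂ) (bs : List (ZMod 4 × (Fin n → Pauli))) (k : ℕ)
    (fail : Bool) : Prop :=
  (fail = true ∧ pulledBack U d = 0) ∨
  (fail = false ∧ (∀ b ∈ bs, (rowOp b).mulVec (pulledBack U d) = pulledBack U d) ∧
    (∀ b ∈ bs, ∃ D, IsDiag U b D) ∧
    (bs.Pairwise fun b b' => ∀ p, IsPivot b.2 p → (b'.2 p).hasX = false) ∧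
    ∀ u : Bits n, (∀ b ∈ bs, ∀ p, IsPivot b.2 p → u p = 0) →
      pulledBack U d u = if u = 0 then (1 / 2) ^ k else 0)

theorem Invariant.init {U : Op n} (hU : U ∈ Matrix.unitaryGroup (Bits n) ℂ) :
    Invariant U (fun _ => 1) [] 0 false := by
  have h₁ : U.conjTranspose * U = 1 := Matrix.mem_unitaryGroup_iff'.1 hU
  refine Or.inr ⟨rfl, by simp, by simp, List.Pairwise.nil, fun u _ => ?_⟩
  simp only [pulledBack, one_mul, Matrix.mulVec_mulVec, h₁, Matrix.one_mulVec]
  simp [zeroState, Pi.single_apply, funext_iff]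

/-- The factors are multiplied from the right and fix `v`, so they are absorbed by `v`. -/
theorem foldl_reduceBy_spec {U : Op n} (hU : U ∈ Matrix.unitaryGroup (Bits n) ℂ)
    (v : Bits n → ℂ) (bs : List (ZMod 4 × (Fin n → Pauli)))
    (h₁ : ∀ b ∈ bs, (rowOp b).mulVec v = v) (h₂ : ∀ b ∈ bs, ∃ D, IsDiag U b D) :
    ∀ r : ZMod 4 × (Fin n → Pauli), (∃ D, IsDiag U r D) →
      (∃ D, IsDiag U (bs.foldl reduceBy r) D) ∧
        (rowOp (bs.foldl reduceBy r)).mulVec v = (rowOp r).mulVec v := by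
  induction bs with
  | nil => exact fun r hr => ⟨hr, rfl⟩
  | cons b bs ih =>
      intro r hr
      have h := ih (fun b hb => h₁ b (by simp [hb])) (fun b hb => h₂ b (by simp [hb])) (reduceBy r b)
      have hb : (∃ D, IsDiag U (reduceBy r b) D) ∧
          (rowOp (reduceBy r b)).mulVec v = (rowOp r).mulVec v := by
        cases hf : isReducible b.2 r.2
        · rw [reduceBy, hf]
          exact ⟨hr, rfl⟩
        · have hs : rowOp (reduceBy r b) = rowOp r * rowOp b := by
            rw [rowOp_mul, reduceBy, hf, cond_true]
          obtain ⟨D, hD⟩ := hr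
          obtain ⟨E, hE⟩ := h₂ b (by simp)
          refine ⟨⟨_, hD.mul hU hE hs⟩, ?_⟩
          rw [hs, ← Matrix.mulVec_mulVec, h₁ b (by simp)]
      rw [List.foldl_cons]
      exact ⟨(h hb.1).1, (h hb.1).2.trans hb.2⟩

/-- The new vector is the average of the old one and its image under the reduced row `s`. If `s`
flips a qubit, the two parts do not overlap on strings vanishing at all pivots, including the new
one; otherwise the old vector is an eigenvector of `s`. -/
theorem Invariant.step {U : Op n} (hU : U ∈ Matrix.unitaryGroup (Bits n) ℂ) {d : Bits n → ℂ}
    {bs : List (ZMod 4 × (Fin n → Pauli))} {k : ℕ} {fail : Bool} (h : Invariant U d bs k fail)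
    {r s : ZMod 4 × (Fin n → Pauli)} {D : Bits n → ℂ} (hr : IsDiag U r D)
    (hs : s = bs.foldl reduceBy r) {x : Bool} (hx : x = true ↔ ∃ i, (s.2 i).hasX = true) :
    Invariant U (fun y => d y * ((1 + D y) / 2)) (bs ++ [s]) (bif x then k + 1 else k)
      (fail || (!x && !decide (s.1 = 0))) := by
  have hUU : U.conjTranspose * U = 1 := Matrix.mem_unitaryGroup_iff'.1 hU
  have hUU' : U * U.conjTranspose = 1 := Matrix.mem_unitaryGroup_iff.1 hU
  set ψ := U.mulVec (zeroState n) with hψ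
  have hv' : pulledBack U (fun y => d y * ((1 + D y) / 2)) =
      (1 / 2 : ℂ) • (pulledBack U d + (rowOp r).mulVec (pulledBack U d)) := by
    rw [pulledBack, pulledBack, hr.mulVec hU, ← Matrix.mulVec_add, ← Matrix.mulVec_smul]
    congr 1
    funext y
    simp only [Pi.smul_apply, Pi.add_apply, smul_eq_mul]
    ring
  rcases h with ⟨rfl, h₀⟩ | ⟨rfl, h₁, h₂, h₃, h₄⟩
  · refine Or.inl ⟨rfl, ?_⟩
    rw [hv', h₀]
    simp
  obtain ⟨⟨E, hE⟩, hsv⟩ := foldl_reduceBy_spec hU (pulledBack U d) bs h₁ h₂ r ⟨D, hr⟩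
  rw [← hs] at hE hsv
  rw [← hsv] at hv'
  have hpiv : ∀ b ∈ bs, ∀ p, IsPivot b.2 p → (s.2 p).hasX = false := by
    intro b hb p hp
    rw [hs]
    exact hasX_foldl_reduceBy_pivot bs h₃ r b p hb hp
  have hss : ∀ f, (rowOp s).mulVec ((rowOp s).mulVec (U.conjTranspose.mulVec f)) =
      U.conjTranspose.mulVec f := by
    intro f
    rw [hE.mulVec hU, hE.mulVec hU]
    congr 1
    funext y
    rw [← mul_assoc, hE.1, one_mul]
  have hpair : (bs ++ [s]).Pairwise fun b b' => ∀ p, IsPivot b.2 p → (b'.2 p).hasX = false := by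
    rw [List.pairwise_append]
    exact ⟨h₃, List.pairwise_singleton _ _, fun b hb b' hb' => by
      rw [List.mem_singleton.1 hb']
      exact hpiv b hb⟩
  have hdiag : ∀ b ∈ bs ++ [s], ∃ D, IsDiag U b D := by
    intro b hb
    rcases List.mem_append.1 hb with hb | hb
    · exact h₂ b hb
    · rw [List.mem_singleton.1 hb]
      exact ⟨E, hE⟩
  cases x with
  | true =>
      refine Or.inr ⟨rfl, ?_, hdiag, hpair, ?_⟩
      · intro b hb
        rw [hv', Matrix.mulVec_smul, Matrix.mulVec_add]
        congr 1
        rcases List.mem_append.1 hb with hb | hb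
        -- Both rows become diagonal after the circuit. Hence `b` still fixes the average.
        · have hcomm : (rowOp b).mulVec ((rowOp s).mulVec (pulledBack U d)) =
              (rowOp s).mulVec ((rowOp b).mulVec (pulledBack U d)) := by
            obtain ⟨F, hF⟩ := h₂ b hb
            rw [pulledBack, hE.mulVec hU, hF.mulVec hU, hF.mulVec hU, hE.mulVec hU]
            congr 1
            funext y
            ring
          rw [hcomm, h₁ b hb]
        · rw [List.mem_singleton.1 hb, pulledBack, hss, add_comm]
      · intro u hu
        obtain ⟨p, hp⟩ : ∃ p, IsPivot s.2 p := by
          refine (exists_isPivot s.2).resolve_left fun h => ?_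
          obtain ⟨i, hi⟩ := hx.1 rfl
          simp [h i] at hi
        -- Only the string `y` obtained from `u` by the flips of `s` can contribute. It vanishes at
        -- the earlier pivots, which `s` does not flip, but not at `p`; so the vector is 0 there by
        -- the invariant.
        have hu₀ : (rowOp s).mulVec (pulledBack U d) u = 0 := by
          rw [rowOp, Matrix.smul_mulVec, Pi.smul_apply, Matrix.mulVec, dotProduct,
            Finset.sum_eq_zero, smul_zero]
          intro y _
          by_cases hy : pauliTensor s.2 u y = 0
          · rw [hy, zero_mul]
          · rw [h₄ y, if_neg, mul_zero]
            · intro h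
              have := (pauliTensor_ne_zero hy p).1 (by
                rw [h, hu s (by simp) p hp]
                rfl)
              simp [hp.1] at this
            · intro b hb p' hp'
              rw [← (pauliTensor_ne_zero hy p').2 (hpiv b hb p' hp')]
              exact hu b (by simp [hb]) p' hp'
        rw [hv', Pi.smul_apply, Pi.add_apply, hu₀, h₄ u fun b hb => hu b (by simp [hb])]
        split_ifs
        · simp [pow_succ, mul_comm]
        · simp
  | false =>
      have hsX : ∀ i, (s.2 i).hasX = false := by
        intro i
        by_contra hi
        simpa using hx.2 ⟨i, by simpa using hi⟩
      have hs₀ : (rowOp s).mulVec (zeroState n) = iPow s.1 • zeroState n := by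
        rw [rowOp, Matrix.smul_mulVec, pauliTensor_mulVec_zeroState hsX]
      have hz : zeroState n = U.conjTranspose.mulVec ψ := by
        rw [hψ, Matrix.mulVec_mulVec, hUU, Matrix.one_mulVec]
      -- Since |0⟩ is an eigenvector of `s`, the output state `ψ` is one of the diagonal operator
      -- `E`. Multiplication by `d` commutes with `E`, so the eigenvalue carries over to the
      -- pulled-back vector.
      have hEψ : (fun y => E y * ψ y) = iPow s.1 • ψ := by
        have h := hs₀
        rw [hz, hE.mulVec hU, ← Matrix.mulVec_smul] at h
        have h' := congrArg U.mulVec h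
        rwa [Matrix.mulVec_mulVec, Matrix.mulVec_mulVec, hUU', Matrix.one_mulVec,
          Matrix.one_mulVec] at h'
      have hsv' : (rowOp s).mulVec (pulledBack U d) = iPow s.1 • pulledBack U d := by
        rw [pulledBack, hE.mulVec hU, ← Matrix.mulVec_smul]
        congr 1
        funext y
        have := congrFun hEψ y
        simp only [Pi.smul_apply, smul_eq_mul] at this ⊢
        rw [mul_left_comm, this, mul_left_comm]
      by_cases hc : s.1 = 0
      · have hv : pulledBack U (fun y => d y * ((1 + D y) / 2)) = pulledBack U d := by
          rw [hv', hsv', hc, iPow_zero, one_smul, ← two_smul ℂ, smul_smul]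
          norm_num
        refine Or.inr ⟨by simp [hc], ?_, hdiag, hpair, ?_⟩
        · intro b hb
          rw [hv]
          rcases List.mem_append.1 hb with hb | hb
          · exact h₁ b hb
          · rw [List.mem_singleton.1 hb, hsv', hc, iPow_zero, one_smul]
        · intro u hu
          rw [hv]
          exact h₄ u fun b hb => hu b (by simp [hb])
      · refine Or.inl ⟨by simp [hc], ?_⟩
        -- Applying `s` twice gives the identity, which excludes the phases ±i; a nonzero `s.1` then
        -- means -1, and the average vanishes.
        have hsq : iPow s.1 * iPow s.1 = 1 := by
          have h := hss ψ
          rw [← hz, hs₀, Matrix.mulVec_smul, hs₀, smul_smul] at h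
          simpa [zeroState] using congrFun h fun _ => 0
        rw [hv', hsv', iPow_eq_neg_one hc hsq]
        simp

end

section

variable {G : Type} {arity : G → ℕ} {n : ℕ}

/-! ### Correctness of the algorithm -/

open Classical in
/-- The indicator function of the bit strings with the requested outcomes. -/
noncomputable def select (o : Fin n → Option (Fin 2)) (x : Bits n) : ℂ :=
  if ∀ i b, o i = some b → x i = b then 1 else 0

/-- The sign by which `Z` at the position `i`, with the sign of the outcome `b`, acts. -/
def outcomeSign (i : Fin n) (b : Fin 2) (x : Bits n) : ℂ := if x i = b then 1 else -1

/-- The indicator of one requested outcome is the projection (1 ± Z_i)/2, split off from the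
remaining ones. -/
theorem select_eq {o : Fin n → Option (Fin 2)} {i : Fin n} {b : Fin 2} (hi : o i = some b)
    (x : Bits n) :
    select o x = (1 + outcomeSign i b x) / 2 * select (Function.update o i none) x := by
  have h : (∀ j c, o j = some c → x j = c) ↔
      x i = b ∧ ∀ j c, Function.update o i none j = some c → x j = c := by
    constructor
    · intro h
      refine ⟨h i b hi, fun j c hj => ?_⟩
      by_cases hji : j = i
      · subst hji
        simp at hj
      · rw [Function.update_of_ne hji] at hj
        exact h j c hj
    · rintro ⟨h₁, h₂⟩ j c hj
      by_cases hji : j = i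
      · subst hji
        rw [hi, Option.some.injEq] at hj
        rw [h₁, hj]
      · exact h₂ j c (by rwa [Function.update_of_ne hji])
  simp only [select, outcomeSign, h]
  by_cases h₁ : x i = b <;> simp [h₁]

theorem select_none {o : Fin n → Option (Fin 2)} (ho : ∀ i, o i = none) (x : Bits n) :
    select o x = 1 := by
  simp [select, ho]

theorem rowOp_outcome (i : Fin n) (b : Fin 2) :
    rowOp (outcomePhase (some b), Function.update (fun _ => Pauli.I) i Pauli.Z) =
      Matrix.diagonal (outcomeSign i b) := by
  ext x y
  rw [rowOp, Matrix.smul_apply, smul_eq_mul]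
  by_cases hxy : x = y
  · subst hxy
    rw [Matrix.diagonal_apply_eq, pauliTensor, Matrix.of_apply, Finset.prod_eq_single i]
    · have hx : x i = 0 ∨ x i = 1 := by
        generalize x i = a
        revert a
        decide
      have hb : b = 0 ∨ b = 1 := by
        revert b
        decide
      rcases hx with hx | hx <;> rcases hb with rfl | rfl <;>
        simp [outcomeSign, outcomePhase, Pauli.toMatrix, hx, iPow_zero, iPow_two]
    · intro j _ hj
      have hI : Function.update (fun _ => Pauli.I) i Pauli.Z j = Pauli.I :=
        Function.update_of_ne hj _ _
      rw [show (outcomePhase (some b), Function.update (fun _ => Pauli.I) i Pauli.Z).2 j = Pauli.I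
        from hI]
      have hx : x j = 0 ∨ x j = 1 := by
        generalize x j = a
        revert a
        decide
      rcases hx with hx | hx <;> simp [Pauli.toMatrix, hx]
    · simp
  · rw [Matrix.diagonal_apply_ne _ hxy]
    by_contra h
    refine hxy (funext fun j => (pauliTensor_ne_zero (right_ne_zero_of_mul h) j).2 ?_)
    by_cases hj : j = i
    · subst hj
      simp [Pauli.hasX]
    · exact congrArg Pauli.hasX (Function.update_of_ne hj Pauli.Z fun _ => Pauli.I)

/-- In ⟨0|U†ΠU|0⟩ each selected `x` contributes the amplitude of `x` times its conjugate. -/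
theorem marginalProb_eq (gate : (g : G) → Op (arity g)) (C : Circuit arity n)
    (m : Fin n → Option (Fin 2)) :
    ((marginalProb gate C m : ℝ) : ℂ) = pulledBack (circuitOp gate C) (select m) 0 := by
  classical
  have h : ∀ x, (circuitOp gate C).mulVec (zeroState n) x = circuitOp gate C x 0 := by
    intro x
    rw [zeroState, Matrix.mulVec_single_one]
    rfl
  rw [marginalProb, Finset.sum_filter, pulledBack, Matrix.mulVec, dotProduct, Complex.ofReal_sum]
  refine Finset.sum_congr rfl fun x _ => ?_
  rw [h, Matrix.conjTranspose_apply, select, outputProb, outputState_eq, h]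
  split_ifs
  · rw [one_mul, Complex.ofReal_pow, ← Complex.conj_mul']
    rfl
  · simp

/-! ### One round of the machine, and the iteration of the rounds -/

/-- The memory between two steps of the algorithm. -/
def restMem (phase : ZMod 4) (hasX found fail : Bool) (out : List (Option Bool))
    (ins : List (Instr arity)) (right : List (Cell arity)) : Mem arity :=
  ⟨⟨none, none, none, none, fun _ => .I, phase, false, hasX, found, fail⟩, [], out, ins, [], right,
    []⟩

/-- The memory when a row has been prepared. -/
def pickedMem (w : Fin n → Pauli) (o : Fin n → Option (Fin 2)) (fail : Bool) (k : ℕ)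
    (ins : List (Instr arity)) : Mem arity :=
  restMem (outcomePhase (pick (cells (arity := arity) w o)).1) false
    (pick (cells (arity := arity) w o)).1.isSome fail
    (List.replicate k (some false) ++ [some true]) ins (pick (cells w o)).2

theorem length_rowInstrs (r : ZMod 4 × (Fin n → Pauli)) :
    (rowInstrs (arity := arity) r).length = n + 1 := by
  simp [rowInstrs]

theorem any_cells (w : Fin n → Pauli) (o : Fin n → Option (Fin 2)) :
    ((cells (arity := arity) w o).any fun e => e.p.hasX) = true ↔ ∃ i, (w i).hasX = true := by
  simp [cells, List.any_eq_true, List.mem_ofFn']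

/-- The time bound for one round of the algorithm. -/
def roundTime (n S : ℕ) : ℕ := S * (8 * n + 18) + 17 * n + 20

theorem run_round (T : Table arity) {w s : Fin n → Pauli} {o : Fin n → Option (Fin 2)}
    {c c' : ZMod 4} {fail : Bool} {k S : ℕ} {ins : List (Instr arity)}
    (hex : exec T ins ⟨c, false, [], cells w o⟩ = ⟨c', false, [], cells s o⟩) {x : Bool}
    (hx : x = ((cells (arity := arity) s o).any fun e => e.p.hasX))
    (hS : ins.length + (n + 1) ≤ S) :
    Run ((execProg T).seq <| recordProg.seq <| restoreProg.seq pickProg)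
      (restMem c false true fail (List.replicate k (some false) ++ [some true]) ins (cells w o))
      (pickedMem s o (fail || (!x && !decide (c' = 0))) (bif x then k + 1 else k)
        (ins ++ rowInstrs (c', s))) (roundTime n S) := by
  have hlen : ∀ w : Fin n → Pauli, (cells (arity := arity) w o).length = n := by simp [cells]
  have h₁ := run_execProg T (restMem c false true fail
    (List.replicate k (some false) ++ [some true]) ins (cells w o)) ⟨rfl, rfl, rfl⟩
    ⟨c, false, [], cells w o⟩
  rw [show (restMem c false true fail (List.replicate k (some false) ++ [some true]) ins
    (cells w o)).ins = ins from rfl, ← exec, hex] at h₁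
  have h₂ := run_recordProg (⟨⟨none, none, none, none, fun _ => .I, c', false, false, true, fail⟩,
    [], List.replicate k (some false) ++ [some true], [], ins.reverse ++ [], cells s o, []⟩ :
      Mem arity) rfl rfl rfl rfl
  simp only [← hx] at h₂
  have hm : (cells (arity := arity) s o).map (Cell.merge false) = cells s o := by
    refine map_merge_false fun e he => ?_
    obtain ⟨i, rfl⟩ := (List.mem_ofFn' _ _).1 he
    rfl
  rw [hm] at h₂
  have h₃ := run_restoreProg (⟨⟨none, none, none, none, fun _ => .I, c', false, x, true,
    fail || (!x && !decide (c' = 0))⟩, [],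
    bif x then some false :: (List.replicate k (some false) ++ [some true])
      else List.replicate k (some false) ++ [some true], [],
    .finish c' :: (((cells s o).map fun e : Cell arity => Instr.entry e.p).reverse ++ (ins.reverse ++ [])),
    cells s o, []⟩ : Mem arity) rfl
  -- Reversing the stack of executed instructions restores their order and puts the new row last.
  have hins : (.finish c' :: (((cells s o).map fun e : Cell arity => Instr.entry e.p).reverse ++
      (ins.reverse ++ []))).reverse ++ [] = ins ++ rowInstrs (arity := arity) (c', s) := by
    simp [rowInstrs, cells, List.map_ofFn, Function.comp_def]
  have hout : (bif x then some false :: (List.replicate k (some false) ++ [some true])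
      else List.replicate k (some false) ++ [some true]) =
      List.replicate (bif x then k + 1 else k) (some false) ++ [some true] := by
    cases x <;> rfl
  simp only [hins, hout] at h₃
  simp only [hout] at h₂
  have h₄ := run_pickProg (⟨⟨none, none, none, none, fun _ => .I, c', false, x, true,
    fail || (!x && !decide (c' = 0))⟩, [],
    List.replicate (bif x then k + 1 else k) (some false) ++ [some true],
    ins ++ rowInstrs (c', s), [], cells s o, []⟩ : Mem arity) rfl rfl rfl
  refine Run.mono (Run.seq h₁ (Run.seq h₂ (Run.seq h₃ h₄))) ?_
  have hi : ins.length * (8 * n + 15) ≤ S * (8 * n + 15) := Nat.mul_le_mul_right _ (by omega)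
  have h18 : S * (8 * n + 18) = S * (8 * n + 15) + 3 * S := by ring
  simp only [Zip.size, hlen, List.length_nil, Nat.zero_add, List.length_cons, List.length_append,
    List.length_reverse, List.length_map, roundTime]
  omega

/-- What is known when all rounds are over. -/
structure IsResult (U : Op n) (o : Fin n → Option (Fin 2)) (S : ℕ) (m : Mem arity) : Prop where
  inp : m.inp = []
  done : m.done = []
  left : m.left = []
  right : m.right.length = n
  ins : m.ins.length ≤ S
  out : ∃ k ≤ n, m.out = List.replicate k (some false) ++ [some true] ∧
    ∃ bs, Invariant U (select o) bs k m.v.fail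

/-- The induction is on a bound `K` for the number of outcomes still requested. The selection is
split into a factor `d` for the outcomes already treated and `select o` for the remaining ones. Each
round adds one row, that is, `n + 1` instructions, and `S` bounds the length of the list throughout.
-/
theorem run_rounds {T : Table arity} {gate : (g : G) → Op (arity g)} (hT : T.Describes gate)
    (hgate : ∀ g, IsClifford (gate g)) (C : Circuit arity n) (m : Fin n → Option (Fin 2)) {S : ℕ}
    (K : ℕ) : ∀ (w : Fin n → Pauli) (o : Fin n → Option (Fin 2)) (fail : Bool) (k : ℕ)
      (bs : List (ZMod 4 × (Fin n → Pauli))) (d : Bits n → ℂ),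
      (Finset.univ.filter fun i => o i ≠ none).card ≤ K → k + K ≤ n →
      ((C.flatMap stepInstrs).reverse ++ bs.flatMap (rowInstrs (arity := arity))).length +
        K * (n + 1) ≤ S →
      Invariant (circuitOp gate C) d bs k fail → (∀ x, select m x = d x * select o x) →
      ∃ m' : Mem arity, IsResult (circuitOp gate C) m S m' ∧
        Run (roundsProg T) (pickedMem w o fail k
          ((C.flatMap stepInstrs).reverse ++ bs.flatMap rowInstrs)) m'
          (K * (roundTime n S + 1) + 1) := by
  have hU := circuitOp_mem_unitaryGroup hgate C
  have hUU : circuitOp gate C * (circuitOp gate C).conjTranspose = 1 :=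
    Matrix.mem_unitaryGroup_iff.1 hU
  -- If no outcome is left, the loop ends even if the bound `K` is not exhausted.
  have h_last : ∀ (K : ℕ) (w : Fin n → Pauli) (o : Fin n → Option (Fin 2)) (fail : Bool) (k : ℕ)
      (bs : List (ZMod 4 × (Fin n → Pauli))) (d : Bits n → ℂ), (∀ i, o i = none) →
      pick (cells (arity := arity) w o) = (none, cells (fun _ => .I) o) → k + K ≤ n →
      ((C.flatMap stepInstrs).reverse ++ bs.flatMap (rowInstrs (arity := arity))).length +
        K * (n + 1) ≤ S →
      Invariant (circuitOp gate C) d bs k fail → (∀ x, select m x = d x * select o x) →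
      ∃ m' : Mem arity, IsResult (circuitOp gate C) m S m' ∧
        Run (roundsProg T) (pickedMem w o fail k
          ((C.flatMap stepInstrs).reverse ++ bs.flatMap rowInstrs)) m'
          (K * (roundTime n S + 1) + 1) := by
    intro K w o fail k bs d ho hp hk hS hinv hd
    refine ⟨pickedMem w o fail k _, ⟨rfl, rfl, rfl, ?_, ?_, k, by omega, rfl, bs, ?_⟩,
      Run.mono (Run.loopFalse ?_) (by omega)⟩
    · rw [show (pickedMem w o fail k _).right = (pick (cells w o)).2 from rfl, hp]
      simp [cells]
    · exact le_trans (Nat.le_add_right _ _) hS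
    · have : select m = d := funext fun x => by rw [hd, select_none ho, mul_one]
      rw [this]
      exact hinv
    · simp [pickedMem, restMem, hp]
  induction K with
  | zero =>
      intro w o fail k bs d hK hk hS hinv hd
      rcases pick_cells (arity := arity) w o with ⟨ho, hp⟩ | ⟨i, b, hi, -⟩
      · exact h_last 0 w o fail k bs d ho hp hk hS hinv hd
      · rw [Nat.le_zero, Finset.card_eq_zero] at hK
        have : i ∈ Finset.univ.filter fun i => o i ≠ none := by simp [hi]
        simp [hK] at this
  | succ K ih =>
      intro w o fail k bs d hK hk hS hinv hd
      rcases pick_cells (arity := arity) w o with ⟨ho, hp⟩ | ⟨i, b, hi, hp⟩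
      · exact h_last (K + 1) w o fail k bs d ho hp hk hS hinv hd
      · obtain ⟨r, hr, hex₁⟩ := exec_circuit (arity := arity) hT (Function.update o i none) C
          (outcomePhase (some b), Function.update (fun _ => Pauli.I) i Pauli.Z)
        have hex₂ := exec_flatMap_rowInstrs T (Function.update o i none) bs r
        set s := bs.foldl reduceBy r with hs
        have hex : exec T ((C.flatMap stepInstrs).reverse ++ bs.flatMap rowInstrs)
            ⟨outcomePhase (some b), false, [],
              cells (Function.update (fun _ => Pauli.I) i Pauli.Z) (Function.update o i none)⟩ =
            ⟨s.1, false, [], cells s.2 (Function.update o i none)⟩ := by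
          rw [exec_append]
          exact (congrArg _ hex₁).trans hex₂
        -- Conjugation by the circuit undoes the pull-back and gives back the signed `Z` at position
        -- `i`.
        have hdiag : IsDiag (circuitOp gate C) r (outcomeSign i b) := by
          refine ⟨fun x => ?_, ?_⟩
          · rw [outcomeSign]
            split_ifs <;> norm_num
          · rw [hr, rowOp_outcome]
            calc _ = (circuitOp gate C * (circuitOp gate C).conjTranspose) *
                Matrix.diagonal (outcomeSign i b) *
                (circuitOp gate C * (circuitOp gate C).conjTranspose) := by
                  simp only [Matrix.mul_assoc]
              _ = _ := by rw [hUU, Matrix.one_mul, Matrix.mul_one]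
        have hSK : ((C.flatMap stepInstrs).reverse ++
            bs.flatMap (rowInstrs (arity := arity))).length + (n + 1) + K * (n + 1) ≤ S := by
          rw [Nat.add_mul, Nat.one_mul] at hS
          omega
        have hrun := run_round T (fail := fail) (k := k) (S := S) hex rfl (by omega)
        set x := (cells (arity := arity) s.2 (Function.update o i none)).any fun e => e.p.hasX
          with hx
        have hinv' := hinv.step hU hdiag hs (x := x) (any_cells _ _)
        have hcard : (Finset.univ.filter fun j => Function.update o i none j ≠ none).card ≤ K := by
          have : (Finset.univ.filter fun j => Function.update o i none j ≠ none) ⊂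
              Finset.univ.filter fun j => o j ≠ none := by
            refine Finset.ssubset_iff_subset_ne.2 ⟨fun j hj => ?_, fun h => ?_⟩
            · rw [Finset.mem_filter] at hj ⊢
              refine ⟨hj.1, fun h => hj.2 ?_⟩
              by_cases hji : j = i
              · rw [hji, Function.update_self]
              · rw [Function.update_of_ne hji, h]
            · have hmem : i ∈ Finset.univ.filter fun j => o j ≠ none := by simp [hi]
              rw [← h] at hmem
              simp at hmem
          have := Finset.card_lt_card this
          omega
        have hflat : (C.flatMap stepInstrs).reverse ++ bs.flatMap (rowInstrs (arity := arity)) ++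
            rowInstrs s = (C.flatMap stepInstrs).reverse ++ (bs ++ [s]).flatMap rowInstrs := by
          simp
        obtain ⟨m', hm', hrun'⟩ := ih s.2 (Function.update o i none)
          (fail || (!x && !decide (s.1 = 0))) (bif x then k + 1 else k) (bs ++ [s]) _ hcard
          (by cases x <;> simp <;> omega)
          (by rw [← hflat, List.length_append, length_rowInstrs]; exact hSK)
          hinv' (fun y => by rw [hd, select_eq hi, mul_assoc])
        refine ⟨m', hm', ?_⟩
        rw [← hflat] at hrun'
        rw [show pickedMem w o fail k ((C.flatMap stepInstrs).reverse ++ bs.flatMap rowInstrs) =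
          restMem (outcomePhase (some b)) false true fail
            (List.replicate k (some false) ++ [some true])
            ((C.flatMap stepInstrs).reverse ++ bs.flatMap rowInstrs)
            (cells (arity := arity) (Function.update (fun _ => Pauli.I) i Pauli.Z)
              (Function.update o i none)) by rw [pickedMem, hp]; rfl]
        refine Run.mono (Run.loopTrue rfl hrun hrun') ?_
        rw [Nat.add_mul K 1]
        omega

/-! ### The output -/

/-- Binary digits are written with the least significant one first, so the leading 1 comes last. -/
theorem encodeNat_two_pow (k : ℕ) :
    Computability.encodeNat (2 ^ k) = List.replicate k false ++ [true] := by
  have h : ∃ p : PosNum, ((p : ℕ) = 2 ^ k) ∧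
      Computability.encodePosNum p = List.replicate k false ++ [true] := by
    induction k with
    | zero => exact ⟨.one, rfl, rfl⟩
    | succ k ih =>
        obtain ⟨p, h₁, h₂⟩ := ih
        refine ⟨.bit0 p, ?_, ?_⟩
        · rw [PosNum.cast_bit0, h₁, pow_succ, mul_two]
        · rw [Computability.encodePosNum, h₂, List.replicate_succ, List.cons_append]
  obtain ⟨p, h₁, h₂⟩ := h
  rw [Computability.encodeNat, ← h₁, PosNum.of_to_nat, Computability.encodeNum, h₂]

theorem encodeNNRat_half_pow (k : ℕ) : encodeNNRat ((1 / 2) ^ k) =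
    some true :: none :: (List.replicate k (some false) ++ [some true]) := by
  have h₁ : ((1 / 2 : ℚ≥0)).num = 1 := by
    rw [one_div, NNRat.num_inv_of_ne_zero two_ne_zero]
    rfl
  have h₂ : ((1 / 2 : ℚ≥0)).den = 2 := by
    rw [one_div, NNRat.den_inv_of_ne_zero two_ne_zero]
    rfl
  have h₃ := encodeNat_two_pow 0
  rw [pow_zero] at h₃
  rw [encodeNNRat, NNRat.num_pow, NNRat.den_pow, h₁, h₂, one_pow, h₃, encodeNat_two_pow]
  simp

theorem encodeNNRat_zero : encodeNNRat 0 = [none, some true] := by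
  have h₃ := encodeNat_two_pow 0
  rw [pow_zero] at h₃
  rw [encodeNNRat, NNRat.num_zero, NNRat.den_zero, h₃]
  rfl

/-- The time bound for the algorithm. -/
noncomputable def timeBound : Polynomial ℕ :=
  .X * ((.X + .X * (.X + 1)) * (8 * .X + 18) + 17 * .X + 20 + 1) + 2 * (.X + .X * (.X + 1)) +
    25 * .X + 30

/-- The memory with the given input and output. -/
def ioMem (inp : List (Sym G)) (out : List (Option Bool)) : Mem arity :=
  ⟨Reg.init arity, inp, out, [], [], [], []⟩

theorem run_mainProg {T : Table arity} {gate : (g : G) → Op (arity g)} (hT : T.Describes gate)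
    (hgate : ∀ g, IsClifford (gate g)) (Q : Query arity) :
    ∃ p : ℚ≥0, (p : ℝ) = marginalProb gate Q.circuit Q.outcome ∧
      ∃ t, t + 1 ≤ timeBound.eval (encodeQuery Q).length ∧
        Run (mainProg T) (ioMem (encodeQuery Q) []) (ioMem [] (encodeNNRat p)) t := by
  obtain ⟨n, C, o⟩ := Q
  set N := (encodeQuery ⟨n, C, o⟩).length with hN
  have hlen : n + (C.flatMap stepInstrs).length ≤ N := by
    have := length_flatMap_stepInstrs_le C
    simp only [hN, encodeQuery, List.length_append, List.length_map, List.length_ofFn]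
    omega
  -- The circuit yields at most `N` instructions, and at most `n` rows of `n + 1` instructions each
  -- are recorded.
  have hS : ((C.flatMap stepInstrs).reverse ++
      ([] : List (ZMod 4 × (Fin n → Pauli))).flatMap (rowInstrs (arity := arity))).length +
      n * (n + 1) ≤ N + N * (N + 1) := by
    have : n * (n + 1) ≤ N * (N + 1) := Nat.mul_le_mul (by omega) (by omega)
    simp only [List.flatMap_nil, List.append_nil, List.length_reverse]
    omega
  obtain ⟨m', hm', hrun⟩ := run_rounds hT hgate C o n (fun _ => .I) o false 0 [] (fun _ => 1)
    ((Finset.card_le_univ _).trans (by simp)) (by omega) hS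
    (Invariant.init (circuitOp_mem_unitaryGroup hgate C)) (fun x => by rw [one_mul])
  obtain ⟨k, hk, hout, bs, hinv⟩ := hm'.out
  have hmarg := marginalProb_eq gate C o
  have hp : ∃ p : ℚ≥0, (p : ℝ) = marginalProb gate C o ∧ encodeNNRat p =
      bif m'.v.fail then [none, some true] else some true :: none :: m'.out := by
    rcases hinv with ⟨hf, h₀⟩ | ⟨hf, -, -, -, h₄⟩
    · refine ⟨0, ?_, ?_⟩
      · rw [h₀, Pi.zero_apply] at hmarg
        rw [Complex.ofReal_eq_zero.1 hmarg]
        simp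
      · rw [hf, cond_true, encodeNNRat_zero]
    · refine ⟨(1 / 2) ^ k, ?_, ?_⟩
      · rw [h₄ 0 (fun _ _ _ _ => rfl), if_pos rfl] at hmarg
        have : (marginalProb gate C o : ℂ) = (((1 / 2 : ℝ) ^ k : ℝ) : ℂ) := by
          rw [hmarg]
          push_cast
          ring
        rw [Complex.ofReal_injective this]
        push_cast
        ring
      · rw [hf, cond_false, encodeNNRat_half_pow, hout]
  obtain ⟨p, hp₁, hp₂⟩ := hp
  have h₁ := run_readProg (arity := arity) (ioMem (encodeQuery ⟨n, C, o⟩) []) rfl ⟨none, [], []⟩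
  rw [show (ioMem (arity := arity) (encodeQuery ⟨n, C, o⟩) []).inp = encodeQuery ⟨n, C, o⟩ from rfl,
    foldl_read_query, ← hN] at h₁
  -- Reading leaves the cells reversed on the left; the return restores the order of the qubits.
  have h₂ := run_rewind (arity := arity) ⟨Reg.init arity, [], [], (C.flatMap stepInstrs).reverse,
    [], [], []⟩ rfl ⟨0, false, (cells (fun _ => .I) o).reverse, []⟩
  have hcells : (cells (arity := arity) (fun _ => .I) o).map (Cell.merge false) =
      cells (fun _ => .I) o := by
    refine map_merge_false fun e he => ?_
    obtain ⟨i, rfl⟩ := (List.mem_ofFn' _ _).1 he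
    rfl
  have hcl : (cells (arity := arity) (fun _ => .I) o).length = n := by simp [cells]
  have hrew : (Zip.mk 0 false (cells (arity := arity) (fun _ => .I) o).reverse []).rewind =
      ⟨0, false, [], cells (fun _ => .I) o⟩ := by
    simp [Zip.rewind, List.map_reverse, hcells, List.sum_reverse, sum_map_twist_false]
  rw [hrew] at h₂
  have h₃ := run_pickProg (arity := arity) ⟨Reg.init arity, [], [some true],
    (C.flatMap stepInstrs).reverse, [], cells (fun _ => .I) o, []⟩ rfl rfl rfl
  rw [List.flatMap_nil, List.append_nil] at hrun
  have h₄ := run_writeProg m' hm'.inp hm'.done hm'.left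
  rw [← hp₂] at h₄
  refine ⟨p, hp₁, _, ?_, Run.seq h₁ (Run.seq h₂ (Run.seq (Run.pushOut _)
    (Run.seq h₃ (Run.seq hrun h₄))))⟩
  have hn : n ≤ N := by omega
  have hB : n * (roundTime n (N + N * (N + 1)) + 1) ≤ N * (roundTime N (N + N * (N + 1)) + 1) := by
    unfold roundTime
    gcongr
  have hins := hm'.ins
  have hol : m'.out.length ≤ n + 1 := by
    rw [hout]
    simpa using hk
  simp only [timeBound, Polynomial.eval_add, Polynomial.eval_mul, Polynomial.eval_X,
    Polynomial.eval_one, Polynomial.eval_ofNat]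
  rw [roundTime] at hB
  simp only [List.length_reverse, hcl, hm'.right]
  rw [roundTime] at hB ⊢
  omega

end

end GottesmanKnill

theorem mainTheorem1 {G : Type} [Fintype G] (arity : G → ℕ)
    (gate : (g : G) → GottesmanKnill.Op (arity g))
    (hgate : ∀ g, GottesmanKnill.IsClifford (gate g)) :
    ∃ p : GottesmanKnill.Query arity → ℚ≥0,
      (∀ Q, ((p Q : ℚ≥0) : ℝ) = GottesmanKnill.marginalProb gate Q.circuit Q.outcome) ∧
      Nonempty (Turing.TM2ComputableInPolyTime
        (GottesmanKnill.encodeQuery (arity := arity)) GottesmanKnill.encodeNNRat p) := by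
  -- The table depends on the gates alone and is fixed before any query, so a single machine serves
  -- all of them.
  obtain ⟨T, hT⟩ := GottesmanKnill.exists_table hgate
  choose p hp t ht u hu hrun using GottesmanKnill.run_mainProg hT hgate
  have hstk : ∀ (l : List (GottesmanKnill.Sym G)),
      (GottesmanKnill.ioMem (arity := arity) l []).stk =
        Function.update (β := fun k => List (GottesmanKnill.Alphabet arity k)) (fun _ => [])
          GottesmanKnill.Stk.inp l := by
    intro l
    funext k
    cases k <;> rfl
  have hstk' : ∀ (l : List (Option Bool)),
      (GottesmanKnill.ioMem (arity := arity) [] l).stk =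
        Function.update (β := fun k => List (GottesmanKnill.Alphabet arity k)) (fun _ => [])
          GottesmanKnill.Stk.out l := by
    intro l
    funext k
    cases k <;> rfl
  have hout : ∀ Q, Nonempty (Turing.TM2OutputsInTime
      ((GottesmanKnill.mainProg T).toTM GottesmanKnill.Stk.inp GottesmanKnill.Stk.out
        (GottesmanKnill.Reg.init arity)) (GottesmanKnill.encodeQuery Q)
      (some (GottesmanKnill.encodeNNRat (p Q)))
      (GottesmanKnill.timeBound.eval (GottesmanKnill.encodeQuery Q).length)) := by
    intro Q
    have h := hrun Q
    rw [hstk, hstk'] at h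
    refine GottesmanKnill.Cmd.toTM_outputs (GottesmanKnill.mainProg T) GottesmanKnill.Stk.inp
      GottesmanKnill.Stk.out (GottesmanKnill.Reg.init arity) _ _ h ?_
    have := hu Q
    have := ht Q
    omega
  refine ⟨p, hp, ⟨{
    tm := (GottesmanKnill.mainProg T).toTM GottesmanKnill.Stk.inp GottesmanKnill.Stk.out
      (GottesmanKnill.Reg.init arity)
    inputAlphabet := Equiv.refl _
    outputAlphabet := Equiv.refl _
    time := GottesmanKnill.timeBound
    outputsFun := fun Q => ?_ }⟩⟩
  -- The words are mapped through identity equivalences of the alphabets, which leaves them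
  -- unchanged.
  exact cast (congrArg₂ (fun l l' => Turing.TM2OutputsInTime ((GottesmanKnill.mainProg T).toTM
    GottesmanKnill.Stk.inp GottesmanKnill.Stk.out (GottesmanKnill.Reg.init arity)) l (some l')
    (GottesmanKnill.timeBound.eval (GottesmanKnill.encodeQuery Q).length))
    (List.map_id (GottesmanKnill.encodeQuery Q)).symm
    (List.map_id (GottesmanKnill.encodeNNRat (p Q))).symm) (hout Q).some
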